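/- **Setting.** Let $M\ge N\ge 1$ and $d_b,d_w$ be integers with $Md_b=Nd_w$. Let $\Omega$ be the set of (simple, labelled) bipartite graphs with $M$ black vertices, all of degree $d_b$, and $N$ white vertices, all of degree $d_w$; a graph is identified with the $M\times N$ block $A$ of its adjacency matrix $X_A=\begin{pmatrix}0&A\\A^*&0\end{pmatrix}$. Let $\mu_{\rm unif}$ be the uniform probability measure on $\Omega$ and $D=\min(d_b,N^2/d_b^3)$. Let $\mathbf e\in\mathbb R^{M+N}$ be the vector with entries $M^{-1/2}$ at black and $N^{-1/2}$ at white vertices, and let $$\mathscr M_{\mathbf e}=\Big\{X=\begin{pmatrix}0&H\\H^*&0\end{pmatrix}:\ H\in \mathbf M_{M\times N}(\mathbb R),\ X\mathbf e=0\Big\}.$$ The normalization of $X_A$ is the element $X\in\mathscr M_{\mathbf e}$ with block $H_{ij}=d_b^{-1/2}\,(A_{ij}-d_b/N)$. For black $i,m$ and white $j,n$ put $\xi_{ij}^{mn}=\Delta_{ij}+\Delta_{mn}-\Delta_{in}-\Delta_{mj}\in\mathscr M_{\mathbf e}$, where $\Delta_{xy}$ is the adjacency matrix of the graph whose only edge is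 $xy$; let $\mathscr X$ be the set of all $\xi_{ij}^{mn}$. Write $\partial_Y$ for the derivative in direction $Y\in\mathscr M_{\mathbf e}$, $\partial_{ij}^{mn}=\partial_{\xi_{ij}^{mn}}$, and $X_{ij}^{mn}=\operatorname{Tr}(\xi_{ij}^{mn}X)$. All sums below run over black $i,m$ and white $j,n$. The generator of the switching Poisson dynamics acts on $f:\Omega\to\mathbb R$ by $$\mathcal Qf(A)=\frac1{4Nd_w}\sum_{i,j,m,n}I_{ij}^{mn}(A)\,\big[f(A-\xi_{ij}^{mn})-f(A)\big],\qquad I_{ij}^{mn}(A)=A_{ij}A_{mn}(1-A_{in})(1-A_{mj}),$$ and the generator of the Ornstein–Uhlenbeck process $dX=N^{-1/2}d\mathbf B-\tfrac12X\,dt$ on $\mathscr M_{\mathbf e}$ is $$\mathscr LF(X)=\frac1{8MN^2}\sum_{i,j,m,n}(\partial_{ij}^{mn})^2F(X)-\frac1{16MN}\sum_{i,j,m,n}X_{ij}^{mn}\,\partial_{ij}^{mn}F(X).$$ For $F\in C^4(\mathscr M_{\mathbf e})$ put $f_F(A)=F(X)$, where $X$ is the normalization of $X_A$, and, for $1\le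 k\le4$ and $r\ge1$, $$\|\partial^kF\|_{r,0}=\Big(\mathbb E_{\mu_{\rm unif}}\Big[\sup_{\theta\in[0,1]^k}\ \sup_{X_1,\dots,X_k\in\mathscr X}\Big|\partial_{X_1}\cdots\partial_{X_k}F\Big(X+d_b^{-1/2}\sum_{l=1}^k\theta_lX_l\Big)\Big|^r\Big]\Big)^{1/r}.$$ **Proposition.** For every $\varepsilon>0$ there is $r_0=r_0(\varepsilon)\ge1$ such that for all $\gamma>0$ and $\alpha_0\ge1$ there is a constant $C>0$ with the following property. Let $N\le M\le\alpha_0N$ and $Md_b=Nd_w$ as above, with $N^\gamma\le d_b\le N^{2/3-\gamma}$. Then for every $r\ge r_0$ and every $F\in C^4(\mathscr M_{\mathbf e})$ there is a function $R:\Omega\to\mathbb R$ such that $$\mathcal Qf_F(A)=\mathscr LF(X)+R(A)\qquad\text{for every }A\in\Omega,\ X\text{ the normalization of }X_A,$$ and $$\big|\mathbb E_{\mu_{\rm unif}}R\big|\ \le\ C\,D^{-1/2}N^{1+\varepsilon}\max_{1\le k\le4}\|\partial^kF\|_{r,0}.$$ -/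

import Mathlib

open scoped BigOperators

attribute [local instance] Matrix.frobeniusNormedAddCommGroup Matrix.frobeniusNormedSpace

noncomputable section

namespace SwitchingDBM

/-- The symmetric matrix `(H, H^*)` with off-diagonal blocks `H` and `H^*`, indexed by the
`M` black and the `N` white vertices. -/
def offDiag {M N : ℕ} (H : Matrix (Fin M) (Fin N) ℝ) :
    Matrix (Fin M ⊕ Fin N) (Fin M ⊕ Fin N) ℝ :=
  Matrix.fromBlocks 0 H H.transpose 0

/-- The vector `e`, equal to `M^{-1/2}` on black and `N^{-1/2}` on white vertices. -/
def eVec (M N : ℕ) : Fin M ⊕ Fin N → ℝ :=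
  Sum.elim (fun _ => 1 / Real.sqrt M) (fun _ => 1 / Real.sqrt N)

/-- The space of symmetric off-diagonal block matrices `X = (H, H^*)` with `X e = 0`. -/
def Me (M N : ℕ) : Submodule ℝ (Matrix (Fin M ⊕ Fin N) (Fin M ⊕ Fin N) ℝ) where
  carrier := {X | (∃ H : Matrix (Fin M) (Fin N) ℝ, X = offDiag H) ∧ X.mulVec (eVec M N) = 0}
  add_mem' := by
    rintro X Y ⟨⟨H, hH⟩, hX⟩ ⟨⟨K, hK⟩, hY⟩
    refine ⟨⟨H + K, ?_⟩, ?_⟩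
    · rw [hH, hK]
      simp [offDiag, Matrix.fromBlocks_add]
    · rw [Matrix.add_mulVec, hX, hY, add_zero]
  zero_mem' := by
    refine ⟨⟨0, ?_⟩, Matrix.zero_mulVec _⟩
    simp [offDiag]
  smul_mem' := by
    rintro c X ⟨⟨H, hH⟩, hX⟩
    refine ⟨⟨c • H, ?_⟩, ?_⟩
    · rw [hH]
      simp [offDiag, Matrix.fromBlocks_smul]
    · rw [Matrix.smul_mulVec, hX, smul_zero]

theorem offDiag_mem_Me {M N : ℕ} {H : Matrix (Fin M) (Fin N) ℝ}
    (hrow : ∀ i, ∑ j, H i j = 0) (hcol : ∀ j, ∑ i, H i j = 0) : offDiag H ∈ Me M N := by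
  refine ⟨⟨H, rfl⟩, ?_⟩
  funext v
  rcases v with i | j
  · simp [offDiag, eVec, Matrix.mulVec, dotProduct, ← Finset.sum_mul, hrow]
  · simp [offDiag, eVec, Matrix.mulVec, dotProduct, ← Finset.sum_mul, hcol]

/-- The block of `ξ_{ij}^{mn}`: `Δ_{ij} + Δ_{mn} - Δ_{in} - Δ_{mj}`. -/
def xiBlock {M N : ℕ} (i : Fin M) (j : Fin N) (m : Fin M) (n : Fin N) :
    Matrix (Fin M) (Fin N) ℝ :=
  Matrix.single i j 1 + Matrix.single m n 1 - Matrix.single i n 1 - Matrix.single m j 1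

theorem xiBlock_row {M N : ℕ} (i : Fin M) (j : Fin N) (m : Fin M) (n : Fin N) (a : Fin M) :
    ∑ b, xiBlock i j m n a b = 0 := by
  simp only [xiBlock, Matrix.add_apply, Matrix.sub_apply, Matrix.single_apply,
    Finset.sum_add_distrib, Finset.sum_sub_distrib, ite_and]
  by_cases h1 : i = a <;> by_cases h2 : m = a <;> simp [h1, h2]

theorem xiBlock_col {M N : ℕ} (i : Fin M) (j : Fin N) (m : Fin M) (n : Fin N) (b : Fin N) :
    ∑ a, xiBlock i j m n a b = 0 := by
  simp only [xiBlock, Matrix.add_apply, Matrix.sub_apply, Matrix.single_apply,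
    Finset.sum_add_distrib, Finset.sum_sub_distrib, ite_and]
  by_cases h1 : j = b <;> by_cases h2 : n = b <;> simp [h1, h2]

/-- The switching direction `ξ_{ij}^{mn}`, a vector of the space `Me M N`. -/
def xi {M N : ℕ} (i : Fin M) (j : Fin N) (m : Fin M) (n : Fin N) : Me M N :=
  ⟨offDiag (xiBlock i j m n), offDiag_mem_Me (xiBlock_row i j m n) (xiBlock_col i j m n)⟩

/-- The set of all switching directions. -/
def switchDirs (M N : ℕ) : Set (Me M N) :=
  {Y | ∃ (i : Fin M) (j : Fin N) (m : Fin M) (n : Fin N), Y = xi i j m n}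

/-- A (simple, labelled) `(d_b, d_w)`-regular bipartite graph on `M` black and `N` white vertices,
given by the block `A` of its adjacency matrix `(A, A^*)`: black vertices are the rows and have
degree `d_b`, white vertices are the columns and have degree `d_w`. -/
def IsBiregular {M N : ℕ} (db dw : ℕ) (A : Matrix (Fin M) (Fin N) ℝ) : Prop :=
  (∀ i j, A i j = 0 ∨ A i j = 1) ∧ (∀ i, ∑ j, A i j = db) ∧ (∀ j, ∑ i, A i j = dw)

/-- The finite set of biregular bipartite graphs. -/
def Graphs (M N db dw : ℕ) : Type :=
  {A : Matrix (Fin M) (Fin N) ℝ // IsBiregular db dw A}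

instance (M N db dw : ℕ) : Finite (Graphs M N db dw) := by
  have h : {A : Fin M → Fin N → ℝ | ∀ i j, A i j ∈ ({0, 1} : Set ℝ)}.Finite :=
    (Set.Finite.pi' fun _ => Set.Finite.pi' fun _ => Set.toFinite _)
  have h' : {A : Matrix (Fin M) (Fin N) ℝ | IsBiregular db dw A}.Finite :=
    Set.Finite.subset h fun A hA i j => hA.1 i j
  exact h'.to_subtype

instance (M N db dw : ℕ) : Fintype (Graphs M N db dw) := Fintype.ofFinite _

/-- Expectation with respect to the uniform probability measure on biregular graphs. -/
def unifE {M N db dw : ℕ} (f : Graphs M N db dw → ℝ) : ℝ :=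
  (∑ A, f A) / (Fintype.card (Graphs M N db dw) : ℝ)

/-- The coefficient `I_{ij}^{mn}(A) = A_{ij} A_{mn} (1 - A_{in}) (1 - A_{mj})`. -/
def indI {M N : ℕ} (A : Matrix (Fin M) (Fin N) ℝ) (i : Fin M) (j : Fin N) (m : Fin M) (n : Fin N) :
    ℝ :=
  A i j * A m n * (1 - A i n) * (1 - A m j)

theorem isBiregular_sub_xiBlock {M N db dw : ℕ} {A : Matrix (Fin M) (Fin N) ℝ}
    (hA : IsBiregular db dw A) {i : Fin M} {j : Fin N} {m : Fin M} {n : Fin N}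
    (hI : indI A i j m n ≠ 0) : IsBiregular db dw (A - xiBlock i j m n) := by
  obtain ⟨h01, hr, hc⟩ := hA
  have hij : A i j = 1 := by
    rcases h01 i j with h | h
    · exact absurd (by simp [indI, h]) hI
    · exact h
  have hmn : A m n = 1 := by
    rcases h01 m n with h | h
    · exact absurd (by simp [indI, h]) hI
    · exact h
  have hin : A i n = 0 := by
    rcases h01 i n with h | h
    · exact h
    · exact absurd (by simp [indI, h]) hI
  have hmj : A m j = 0 := by
    rcases h01 m j with h | h
    · exact h
    · exact absurd (by simp [indI, h]) hI
  have him : i ≠ m := by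
    rintro rfl
    rw [hij] at hmj
    exact one_ne_zero hmj
  have hjn : j ≠ n := by
    rintro rfl
    rw [hij] at hin
    exact one_ne_zero hin
  refine ⟨fun a b => ?_, fun a => ?_, fun b => ?_⟩
  · simp only [xiBlock, Matrix.add_apply, Matrix.sub_apply, Matrix.single_apply]
    by_cases ha : i = a
    · subst ha
      by_cases hb : j = b
      · subst hb
        simp [him.symm, hjn.symm, hij]
      · by_cases hb' : n = b
        · subst hb'
          simp [him.symm, hb, hin]
        · simpa [him.symm, hb, hb'] using h01 i b
    · by_cases ha' : m = a
      · subst ha'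
        by_cases hb : j = b
        · subst hb
          simp [him, hjn.symm, hmj]
        · by_cases hb' : n = b
          · subst hb'
            simp [him, hb, hmn]
          · simpa [him, hb, hb'] using h01 m b
      · simpa [ha, ha'] using h01 a b
  · simp only [Matrix.sub_apply, Finset.sum_sub_distrib, xiBlock_row, hr, sub_zero]
  · simp only [Matrix.sub_apply, Finset.sum_sub_distrib, xiBlock_col, hc, sub_zero]

open Classical in
/-- The switched graph `A - ξ_{ij}^{mn}` when `I_{ij}^{mn}(A)` is non-zero. When it is zero the value
is irrelevant (it has weight zero in the generator); we then put the graph `A` itself. -/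
def switch {M N db dw : ℕ} (A : Graphs M N db dw) (i : Fin M) (j : Fin N) (m : Fin M) (n : Fin N) :
    Graphs M N db dw :=
  if hI : indI A.1 i j m n ≠ 0 then ⟨A.1 - xiBlock i j m n, isBiregular_sub_xiBlock A.2 hI⟩ else A

/-- The generator `Q` of the switching Poisson process, acting on functions on graphs. -/
def genQ {M N db dw : ℕ} (f : Graphs M N db dw → ℝ) (A : Graphs M N db dw) : ℝ :=
  1 / (4 * (N : ℝ) * (dw : ℝ)) *
    ∑ i : Fin M, ∑ j : Fin N, ∑ m : Fin M, ∑ n : Fin N,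
      indI A.1 i j m n * (f (switch A i j m n) - f A)

theorem double_count {M N db dw : ℕ} (A : Graphs M N db dw) : (M : ℝ) * db = N * dw := by
  have h := Finset.sum_comm (s := (Finset.univ : Finset (Fin M)))
    (t := (Finset.univ : Finset (Fin N))) (f := fun i j => A.1 i j)
  simpa [A.2.2.1, A.2.2.2] using h

/-- The block `H = d_b^{-1/2} (A - d_b / N)` of the normalized adjacency matrix. -/
def normalizedBlock {M N db dw : ℕ} (A : Graphs M N db dw) : Matrix (Fin M) (Fin N) ℝ :=
  Matrix.of fun i j => (db : ℝ) ^ (-(1 / 2) : ℝ) * (A.1 i j - (db : ℝ) / N)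

theorem normalizedBlock_row {M N db dw : ℕ} (A : Graphs M N db dw) (i : Fin M) :
    ∑ j, normalizedBlock A i j = 0 := by
  have h := A.2.2.1 i
  rcases Nat.eq_zero_or_pos N with rfl | hN
  · simp
  · have hN' : (N : ℝ) ≠ 0 := by positivity
    simp only [normalizedBlock, Matrix.of_apply, ← Finset.mul_sum, Finset.sum_sub_distrib, h]
    simp [mul_div_cancel₀ _ hN']

theorem normalizedBlock_col {M N db dw : ℕ} (A : Graphs M N db dw) (j : Fin N) :
    ∑ i, normalizedBlock A i j = 0 := by
  have h := A.2.2.2 j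
  have hN : 0 < N := j.pos
  have hN' : (N : ℝ) ≠ 0 := by positivity
  have hd : (M : ℝ) * ((db : ℝ) / N) = dw := by
    rw [← mul_div_assoc, double_count A]
    field_simp
  simp only [normalizedBlock, Matrix.of_apply, ← Finset.mul_sum, Finset.sum_sub_distrib, h]
  simp [hd]

/-- The normalized adjacency matrix `X = (H, H^*)`. -/
def normalized {M N db dw : ℕ} (A : Graphs M N db dw) : Me M N :=
  ⟨offDiag (normalizedBlock A), offDiag_mem_Me (normalizedBlock_row A) (normalizedBlock_col A)⟩

/-- The function `f_F` on graphs, `f_F(X_A) = F(X)`. -/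
def fF {M N : ℕ} (db dw : ℕ) (F : Me M N → ℝ) : Graphs M N db dw → ℝ :=
  fun A => F (normalized A)

/-- The generator `L` of the Ornstein-Uhlenbeck process `dX = N^{-1/2} dB - X dt / 2` on `Me M N`,
`L = (8 M N²)⁻¹ ∑ (∂_{ij}^{mn})² - (16 M N)⁻¹ ∑ X_{ij}^{mn} ∂_{ij}^{mn}`,
where `∂_{ij}^{mn}` is the derivative in the direction `ξ_{ij}^{mn}` and
`X_{ij}^{mn} = Tr (ξ_{ij}^{mn} X)`. -/
def genL {M N : ℕ} (F : Me M N → ℝ) (X : Me M N) : ℝ :=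
  1 / (8 * (M : ℝ) * (N : ℝ) ^ 2) *
      (∑ i : Fin M, ∑ j : Fin N, ∑ m : Fin M, ∑ n : Fin N,
        iteratedFDeriv ℝ 2 F X (fun _ => xi i j m n))
    - 1 / (16 * (M : ℝ) * (N : ℝ)) *
      (∑ i : Fin M, ∑ j : Fin N, ∑ m : Fin M, ∑ n : Fin N,
        Matrix.trace ((xi i j m n).1 * X.1) * fderiv ℝ F X (xi i j m n))

/-- `sup_θ sup_Ξ |∂_{Ξ_1} ⋯ ∂_{Ξ_k} F (X + d_b^{-1/2} ∑ θ_i Ξ_i)|`, over `θ ∈ [0,1]^k` and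
switching directions `Ξ_1, …, Ξ_k`. -/
def supDeriv {M N : ℕ} (db k : ℕ) (F : Me M N → ℝ) (X : Me M N) : ℝ :=
  ⨆ p : (Fin k → Set.Icc (0 : ℝ) 1) × (Fin k → switchDirs M N),
    |iteratedFDeriv ℝ k F
      (X + (db : ℝ) ^ (-(1 / 2) : ℝ) • ∑ l, (p.1 l : ℝ) • (p.2 l : Me M N))
      (fun l => (p.2 l : Me M N))|

/-- The seminorm `‖∂^k F‖_{r,0}`, for the normalized adjacency matrix of a uniform random graph. -/
def derivSeminorm {M N : ℕ} (db dw k : ℕ) (r : ℝ) (F : Me M N → ℝ) : ℝ :=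
  (unifE fun A : Graphs M N db dw => supDeriv db k F (normalized A) ^ r) ^ (1 / r)

/-- `max_{1 ≤ k ≤ 4} ‖∂^k F‖_{r,0}`. -/
def maxDerivSeminorm {M N : ℕ} (db dw : ℕ) (r : ℝ) (F : Me M N → ℝ) : ℝ :=
  (Finset.Icc 1 4).sup' ⟨1, by simp⟩ fun k => derivSeminorm db dw k r F

/-- The sparsity parameter `D = min (d_b, N² / d_b³)`. -/
def sparsity (N db : ℕ) : ℝ := min (db : ℝ) ((N : ℝ) ^ 2 / (db : ℝ) ^ 3)

end SwitchingDBM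

end

noncomputable section

namespace SwitchingDBM

variable {M N db dw : ℕ}

/-! ### Quadruple sums -/

/-! Take R to be the difference of the two generators and write q = d_b^{-1/2}. A switching moves X
by -qξ, so a second order Taylor expansion turns the jump generator into first and second
derivatives of F weighted by I, with a remainder of order Mq times a third derivative
(`abs_genQ_sub_le`). Replacing I by A_ij A_mn costs only a count of three-edge paths
(`abs_sum_indI_mul_sub_le`).

With the weights A_ij A_mn, the first order part equals the Ornstein–Uhlenbeck drift exactly, by
regularity and linearity of the derivative in ξ (`sum_edge_pairs_mul`, `drift_eq`).

At second order the diffusion carries the constant weight (d_b/N)² instead of A_ij A_mn. By symmetry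
the discrepancy is the sum of the centred variables A_ij - d_b/N against `edgeDeriv₂`, and it is
controlled only on average. Up to three-edge paths, N d_w (A_ij - d_b/N) is the sum over m, n of
I_ij^mn - I_in^mj (`sum_indI_sub_indI`). Reversibility under the uniform measure
(`sum_indI_mul_switch`) moves this difference onto `edgeDeriv₂`, which a single switching changes
little (`abs_edgeDeriv₂_switch_sub_le`).

The errors have orders q d_b d_w, d_w + 1/d_b and Mq, against the suprema of the derivatives of
orders 1, 2 and 3. As d_w ≤ α₀ d_b and M ≤ α₀ N, all are O(N D^{-1/2}): q d_b² = N (N²/d_b³)^{-1/2}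
and qN = N d_b^{-1/2}. The power mean inequality passes from averages to the r-norms. -/

theorem abs_sum_four_le {f g : Fin M → Fin N → Fin M → Fin N → ℝ}
    (h : ∀ i j m n, |f i j m n| ≤ g i j m n) :
    |∑ i, ∑ j, ∑ m, ∑ n, f i j m n| ≤ ∑ i, ∑ j, ∑ m, ∑ n, g i j m n := by
  refine (Finset.abs_sum_le_sum_abs _ _).trans (Finset.sum_le_sum fun i _ => ?_)
  refine (Finset.abs_sum_le_sum_abs _ _).trans (Finset.sum_le_sum fun j _ => ?_)
  refine (Finset.abs_sum_le_sum_abs _ _).trans (Finset.sum_le_sum fun m _ => ?_)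
  exact (Finset.abs_sum_le_sum_abs _ _).trans (Finset.sum_le_sum fun n _ => h i j m n)

theorem sum_four_le {f g : Fin M → Fin N → Fin M → Fin N → ℝ}
    (h : ∀ i j m n, f i j m n ≤ g i j m n) :
    ∑ i, ∑ j, ∑ m, ∑ n, f i j m n ≤ ∑ i, ∑ j, ∑ m, ∑ n, g i j m n :=
  Finset.sum_le_sum fun i _ => Finset.sum_le_sum fun j _ => Finset.sum_le_sum fun m _ =>
    Finset.sum_le_sum fun n _ => h i j m n

theorem sum_four_swap_columns (f : Fin M → Fin N → Fin M → Fin N → ℝ) :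
    ∑ i, ∑ j, ∑ m, ∑ n, f i n m j = ∑ i, ∑ j, ∑ m, ∑ n, f i j m n := by
  refine Finset.sum_congr rfl fun i _ => ?_
  calc ∑ j, ∑ m, ∑ n, f i n m j = ∑ m, ∑ j, ∑ n, f i n m j := Finset.sum_comm
    _ = ∑ m, ∑ n, ∑ j, f i n m j := Finset.sum_congr rfl fun m _ => Finset.sum_comm
    _ = ∑ n, ∑ m, ∑ j, f i n m j := Finset.sum_comm

theorem sum_four_swap_pairs (f : Fin M → Fin N → Fin M → Fin N → ℝ) :
    ∑ i, ∑ j, ∑ m, ∑ n, f m n i j = ∑ i, ∑ j, ∑ m, ∑ n, f i j m n := by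
  have h := Finset.sum_comm (s := (Finset.univ : Finset (Fin M × Fin N)))
    (t := (Finset.univ : Finset (Fin M × Fin N))) (f := fun p q => f q.1 q.2 p.1 p.2)
  simpa only [Fintype.sum_prod_type] using h

/-! ### Edge counts in a biregular graph -/

namespace IsBiregular

variable {A : Matrix (Fin M) (Fin N) ℝ}

theorem nonneg (hA : IsBiregular db dw A) (i : Fin M) (j : Fin N) : 0 ≤ A i j := by
  rcases hA.1 i j with h | h <;> simp [h]

theorem le_one (hA : IsBiregular db dw A) (i : Fin M) (j : Fin N) : A i j ≤ 1 := by
  rcases hA.1 i j with h | h <;> simp [h]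

theorem sum_row (hA : IsBiregular db dw A) (i : Fin M) : ∑ j, A i j = db := hA.2.1 i

theorem sum_col (hA : IsBiregular db dw A) (j : Fin N) : ∑ i, A i j = dw := hA.2.2 j

theorem sum_edges (hA : IsBiregular db dw A) : ∑ i, ∑ j, A i j = N * dw := by
  refine Finset.sum_comm.trans ?_
  simp [hA.sum_col]

theorem sum_edge_pairs (hA : IsBiregular db dw A) :
    ∑ i, ∑ j, ∑ m, ∑ n, A i j * A m n = ((N : ℝ) * dw) ^ 2 := by
  simp only [← Finset.mul_sum, ← Finset.sum_mul, hA.sum_edges]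
  ring

theorem sum_adjacent_edges_row (hA : IsBiregular db dw A) (i : Fin M) (j : Fin N) :
    ∑ m, ∑ n, A i j * A m n * A i n = A i j * (db * dw) := by
  refine Finset.sum_comm.trans ?_
  simp only [mul_assoc, ← Finset.mul_sum, ← Finset.sum_mul, hA.sum_col, hA.sum_row]
  ring

theorem sum_adjacent_edges_col (hA : IsBiregular db dw A) (i : Fin M) (j : Fin N) :
    ∑ m, ∑ n, A i j * A m n * A m j = A i j * (db * dw) := by
  simp only [← Finset.mul_sum, ← Finset.sum_mul, hA.sum_col, hA.sum_row, mul_assoc]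

theorem sum_opposite_edges (hA : IsBiregular db dw A) (i : Fin M) (j : Fin N) :
    ∑ m, ∑ n, A i n * A m j = db * dw := by
  simp only [← Finset.mul_sum, ← Finset.sum_mul, hA.sum_col, hA.sum_row]

theorem sum_paths_row (hA : IsBiregular db dw A) :
    ∑ i, ∑ j, ∑ m, ∑ n, A i j * A m n * A i n = N * dw * (db * dw) := by
  simp only [hA.sum_adjacent_edges_row]
  simp only [← Finset.sum_mul, hA.sum_edges]

theorem sum_paths_col (hA : IsBiregular db dw A) :
    ∑ i, ∑ j, ∑ m, ∑ n, A i j * A m n * A m j = N * dw * (db * dw) := by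
  simp only [hA.sum_adjacent_edges_col]
  simp only [← Finset.sum_mul, hA.sum_edges]

/-- The number of paths of length three from `i` to `j`. -/
def pathCount (A : Matrix (Fin M) (Fin N) ℝ) (i : Fin M) (j : Fin N) : ℝ :=
  ∑ m, ∑ n, A i n * A m n * A m j

theorem pathCount_nonneg (hA : IsBiregular db dw A) (i : Fin M) (j : Fin N) : 0 ≤ pathCount A i j :=
  Finset.sum_nonneg fun m _ => Finset.sum_nonneg fun n _ =>
    mul_nonneg (mul_nonneg (hA.nonneg i n) (hA.nonneg m n)) (hA.nonneg m j)

/-- Exchanging the columns j and n turns these paths into the ones counted by `sum_paths_col`. -/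
theorem sum_pathCount (hA : IsBiregular db dw A) :
    ∑ i, ∑ j, pathCount A i j = N * dw * (db * dw) := by
  rw [← hA.sum_paths_col, ← sum_four_swap_columns]
  unfold pathCount
  refine Finset.sum_congr rfl fun i _ => Finset.sum_congr rfl fun j _ =>
    Finset.sum_congr rfl fun m _ => Finset.sum_congr rfl fun n _ => by ring

theorem indI_nonneg (hA : IsBiregular db dw A) (i : Fin M) (j : Fin N) (m : Fin M) (n : Fin N) :
    0 ≤ indI A i j m n := by
  have h1 := hA.nonneg i j
  have h2 := hA.nonneg m n
  have h3 := sub_nonneg.2 (hA.le_one i n)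
  have h4 := sub_nonneg.2 (hA.le_one m j)
  unfold indI
  positivity

/-- A union bound: the two weights differ only if one of the forbidden edges `i n`, `m j` is
present. -/
theorem abs_indI_sub_le (hA : IsBiregular db dw A) (i : Fin M) (j : Fin N) (m : Fin M) (n : Fin N) :
    |indI A i j m n - A i j * A m n| ≤
      A i j * A m n * A i n + A i j * A m n * A m j := by
  unfold indI
  rcases hA.1 i j with h1 | h1 <;> rcases hA.1 m n with h2 | h2 <;>
    rcases hA.1 i n with h3 | h3 <;> rcases hA.1 m j with h4 | h4 <;> simp [h1, h2, h3, h4]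

theorem indI_le (hA : IsBiregular db dw A) (i : Fin M) (j : Fin N) (m : Fin M) (n : Fin N) :
    indI A i j m n ≤ A i j * A m n := by
  unfold indI
  rcases hA.1 i j with h1 | h1 <;> rcases hA.1 m n with h2 | h2 <;>
    rcases hA.1 i n with h3 | h3 <;> rcases hA.1 m j with h4 | h4 <;> simp [h1, h2, h3, h4]

theorem sum_indI_le (hA : IsBiregular db dw A) :
    ∑ i, ∑ j, ∑ m, ∑ n, indI A i j m n ≤ ((N : ℝ) * dw) ^ 2 := by
  rw [← hA.sum_edge_pairs]
  exact sum_four_le hA.indI_le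

/-- Replacing `indI` by the product of two edge variables costs only paths of length three. -/
theorem abs_sum_indI_mul_sub_le (hA : IsBiregular db dw A)
    (G : Fin M → Fin N → Fin M → Fin N → ℝ) {S : ℝ}
    (hG : ∀ i j m n, |G i j m n| ≤ S) :
    |∑ i, ∑ j, ∑ m, ∑ n, indI A i j m n * G i j m n
      - ∑ i, ∑ j, ∑ m, ∑ n, A i j * A m n * G i j m n| ≤ 2 * (N * dw * (db * dw)) * S := by
  simp only [← Finset.sum_sub_distrib, ← sub_mul]
  calc _ ≤ ∑ i, ∑ j, ∑ m, ∑ n,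
        (A i j * A m n * A i n + A i j * A m n * A m j) * S := by
        refine abs_sum_four_le fun i j m n => ?_
        rw [abs_mul]
        exact mul_le_mul (hA.abs_indI_sub_le i j m n) (hG i j m n) (abs_nonneg _)
          ((abs_nonneg _).trans (hA.abs_indI_sub_le i j m n))
    _ = _ := by
        simp only [add_mul, Finset.sum_add_distrib]
        simp only [← Finset.sum_mul _ _ S, hA.sum_paths_row, hA.sum_paths_col]
        ring

/-- In the difference of a switching and its reverse the quartic terms cancel. The quadratic terms
sum to N d_w (A_ij - d_b/N), and the cubic ones are the error. -/
theorem sum_indI_sub_indI (hA : IsBiregular db dw A) (i : Fin M) (j : Fin N) :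
    ∑ m, ∑ n, (indI A i j m n - indI A i n m j) =
      N * dw * A i j - db * dw - A i j * (db * dw) + pathCount A i j := by
  have h : ∀ m n, indI A i j m n - indI A i n m j =
      A i j * A m n - A i n * A m j - A i j * A m n * A i n
        - A i j * A m n * A m j + A i j * (A i n * A m j)
        + A i n * A m n * A m j := fun m n => by unfold indI; ring
  simp only [h, Finset.sum_add_distrib, Finset.sum_sub_distrib, hA.sum_opposite_edges,
    hA.sum_adjacent_edges_row, hA.sum_adjacent_edges_col]
  simp only [← Finset.mul_sum, hA.sum_edges, hA.sum_opposite_edges, pathCount]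
  ring

end IsBiregular

/-! ### Switching directions -/

theorem offDiag_add (H K : Matrix (Fin M) (Fin N) ℝ) :
    offDiag (H + K) = offDiag H + offDiag K := by
  simp [offDiag, Matrix.fromBlocks_add]

theorem offDiag_smul (c : ℝ) (H : Matrix (Fin M) (Fin N) ℝ) : offDiag (c • H) = c • offDiag H := by
  simp [offDiag, Matrix.fromBlocks_smul]

theorem xi_swap_columns (i : Fin M) (j : Fin N) (m : Fin M) (n : Fin N) :
    xi i n m j = -xi i j m n := by
  refine Subtype.ext ?_
  have h : xiBlock i n m j = (-1 : ℝ) • xiBlock i j m n := by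
    rw [neg_one_smul]
    unfold xiBlock
    abel
  show offDiag _ = -offDiag _
  rw [h, offDiag_smul, neg_one_smul]

theorem xi_swap_pairs (i : Fin M) (j : Fin N) (m : Fin M) (n : Fin N) :
    xi m n i j = xi i j m n := by
  refine Subtype.ext ?_
  have h : xiBlock m n i j = xiBlock i j m n := by
    unfold xiBlock
    abel
  show offDiag _ = offDiag _
  rw [h]

/-- All terms at the base vertices cancel. Hence any linear functional of ξ has the form u_ij + u_mn
- u_in - u_mj, as `sum_edge_pairs_mul` requires. -/
theorem xi_eq_add_sub (i₀ : Fin M) (j₀ : Fin N) (i : Fin M) (j : Fin N) (m : Fin M) (n : Fin N) :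
    xi i j m n = xi i j i₀ j₀ + xi m n i₀ j₀ - xi i n i₀ j₀ - xi m j i₀ j₀ := by
  rw [sub_eq_add_neg, sub_eq_add_neg, ← xi_swap_columns, ← xi_swap_columns]
  refine Subtype.ext ?_
  show offDiag _ = offDiag _ + offDiag _ + offDiag _ + offDiag _
  rw [← offDiag_add, ← offDiag_add, ← offDiag_add]
  congr 1
  unfold xiBlock
  abel

theorem trace_xi_mul_normalized (A : Graphs M N db dw)
    (i : Fin M) (j : Fin N) (m : Fin M) (n : Fin N) :
    Matrix.trace ((xi i j m n).1 * (normalized A).1) =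
      2 * (db : ℝ) ^ (-(1 / 2) : ℝ) * (A.1 i j + A.1 m n - A.1 i n - A.1 m j) := by
  have h : ∀ H : Matrix (Fin M) (Fin N) ℝ,
      Matrix.trace (offDiag (xiBlock i j m n) * offDiag H) =
        2 * (H i j + H m n - H i n - H m j) := fun H => by
    have h1 : Matrix.trace (xiBlock i j m n * H.transpose) = H i j + H m n - H i n - H m j := by
      simp [xiBlock, Matrix.add_mul, Matrix.sub_mul, Matrix.trace_single_mul]
    have h2 : Matrix.trace ((xiBlock i j m n).transpose * H) =
        Matrix.trace (xiBlock i j m n * H.transpose) := by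
      rw [← Matrix.trace_transpose, Matrix.transpose_mul, Matrix.transpose_transpose,
        Matrix.trace_mul_comm]
    have h3 : ∀ (P : Matrix (Fin M) (Fin M) ℝ) (Q R) (S : Matrix (Fin N) (Fin N) ℝ),
        Matrix.trace (Matrix.fromBlocks P Q R S) = Matrix.trace P + Matrix.trace S :=
      fun P Q R S => Fintype.sum_sum_type _
    rw [offDiag, offDiag, Matrix.fromBlocks_multiply, h3]
    simp only [zero_add, add_zero, Matrix.mul_zero]
    rw [h2, h1]
    ring
  refine (h _).trans ?_
  simp only [normalizedBlock, Matrix.of_apply]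
  ring

theorem switch_val (A : Graphs M N db dw) {i : Fin M} {j : Fin N} {m : Fin M} {n : Fin N}
    (hI : indI A.1 i j m n ≠ 0) : (switch A i j m n).1 = A.1 - xiBlock i j m n :=
  congrArg Subtype.val (dif_pos hI)

/-- The displacement -qξ is written as a positive multiple of another switching direction, so that
the segment it spans lies in the range θ ∈ [0,1] of `supDeriv`. -/
theorem normalized_switch (A : Graphs M N db dw) {i : Fin M} {j : Fin N} {m : Fin M} {n : Fin N}
    (hI : indI A.1 i j m n ≠ 0) :
    normalized (switch A i j m n) =
      normalized A + (db : ℝ) ^ (-(1 / 2) : ℝ) • xi i n m j := by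
  refine Subtype.ext ?_
  rw [xi_swap_columns, smul_neg, ← sub_eq_add_neg, sub_eq_add_neg, ← neg_smul]
  show offDiag _ = offDiag _ + _ • offDiag _
  rw [← offDiag_smul, ← offDiag_add]
  congr 1
  ext a b
  simp only [normalizedBlock, Matrix.of_apply, switch_val A hI, Matrix.add_apply, Matrix.smul_apply,
    Matrix.sub_apply, smul_eq_mul]
  ring

/-! ### Reversibility of the switching dynamics -/

theorem indI_switch (A : Graphs M N db dw) {i : Fin M} {j : Fin N} {m : Fin M} {n : Fin N}
    (hI : indI A.1 i j m n ≠ 0) :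
    indI (switch A i j m n).1 i n m j = 1 ∧ indI A.1 i j m n = 1 := by
  have hij : A.1 i j = 1 := (A.2.1 i j).resolve_left fun h => hI (by simp [indI, h])
  have hmn : A.1 m n = 1 := (A.2.1 m n).resolve_left fun h => hI (by simp [indI, h])
  have hin : A.1 i n = 0 := (A.2.1 i n).resolve_right fun h => hI (by simp [indI, h])
  have hmj : A.1 m j = 0 := (A.2.1 m j).resolve_right fun h => hI (by simp [indI, h])
  have him : i ≠ m := by
    rintro rfl
    simp [hij] at hmj
  have hjn : j ≠ n := by
    rintro rfl
    simp [hij] at hin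
  rw [switch_val A hI]
  simp [indI, xiBlock, hij, hmn, hin, hmj, him, hjn, him.symm, hjn.symm]

theorem switch_switch (A : Graphs M N db dw) {i : Fin M} {j : Fin N} {m : Fin M} {n : Fin N}
    (hI : indI A.1 i j m n ≠ 0) : switch (switch A i j m n) i n m j = A := by
  have h : indI (switch A i j m n).1 i n m j ≠ 0 := by
    rw [(indI_switch A hI).1]
    exact one_ne_zero
  refine Subtype.ext ?_
  rw [switch_val _ h, switch_val A hI]
  unfold xiBlock
  abel

/-- Detailed balance for the uniform measure. -/
theorem sum_indI_mul_switch (i : Fin M) (j : Fin N) (m : Fin M) (n : Fin N)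
    (g : Graphs M N db dw → ℝ) :
    ∑ A : Graphs M N db dw, indI A.1 i j m n * g (switch A i j m n) =
      ∑ A : Graphs M N db dw, indI A.1 i n m j * g A := by
  classical
  -- On the supports of the two weights, switching is a bijection with inverse the reverse
  -- switching; the default value of `switch` elsewhere never matters.
  refine Finset.sum_bij_ne_zero (fun A _ _ => switch A i j m n) (fun _ _ _ => Finset.mem_univ _)
    (fun A _ hA B _ hB h => ?_) (fun B _ hB => ?_) (fun A _ hA => ?_)
  · rw [← switch_switch A (left_ne_zero_of_mul hA), h, switch_switch B (left_ne_zero_of_mul hB)]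
  · have hB' := left_ne_zero_of_mul hB
    have h := indI_switch B hB'
    refine ⟨switch B i n m j, Finset.mem_univ _, ?_, switch_switch B hB'⟩
    rw [switch_switch B hB', h.1, ← h.2]
    exact hB
  · have h := indI_switch A (left_ne_zero_of_mul hA)
    rw [h.1, h.2]

theorem sum_graphs_comm (f : Graphs M N db dw → Fin M → Fin N → Fin M → Fin N → ℝ) :
    ∑ A, ∑ i, ∑ j, ∑ m, ∑ n, f A i j m n = ∑ i, ∑ j, ∑ m, ∑ n, ∑ A, f A i j m n := by
  rw [Finset.sum_comm]
  refine Finset.sum_congr rfl fun i _ => ?_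
  rw [Finset.sum_comm]
  refine Finset.sum_congr rfl fun j _ => ?_
  rw [Finset.sum_comm]
  exact Finset.sum_congr rfl fun m _ => Finset.sum_comm

/-! ### Taylor expansion along a line -/

section Line

variable {E : Type*} [NormedAddCommGroup E] [NormedSpace ℝ E] {F : E → ℝ} {n : WithTop ℕ∞}

theorem hasDerivAt_iteratedFDeriv_line {k : ℕ} (hF : ContDiff ℝ n F) (hk : (k : WithTop ℕ∞) < n)
    (x v : E) (m : Fin k → E) (t : ℝ) :
    HasDerivAt (fun s : ℝ => iteratedFDeriv ℝ k F (x + s • v) m)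
      (iteratedFDeriv ℝ (k + 1) F (x + t • v) (Fin.cons v m)) t := by
  have h1 : HasDerivAt (fun s : ℝ => x + s • v) v t := by
    simpa using ((hasDerivAt_id t).smul_const v).const_add x
  have h2 := ((hF.differentiable_iteratedFDeriv hk) (x + t • v)).hasFDerivAt
  have h3 := h2.comp_hasDerivAt t h1
  have h4 := (ContinuousMultilinearMap.apply ℝ (fun _ : Fin k => E) ℝ m).hasFDerivAt.comp_hasDerivAt
    t h3
  rw [iteratedFDeriv_succ_apply_left]
  exact h4

theorem abs_iteratedFDeriv_add_sub_le {k : ℕ} (hF : ContDiff ℝ n F) (hk : (k : WithTop ℕ∞) < n)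
    (x v : E) (m : Fin k → E) {C : ℝ}
    (hC : ∀ t ∈ Set.Icc (0 : ℝ) 1,
      |iteratedFDeriv ℝ (k + 1) F (x + t • v) (Fin.cons v m)| ≤ C) :
    |iteratedFDeriv ℝ k F (x + v) m - iteratedFDeriv ℝ k F x m| ≤ C := by
  have h := norm_image_sub_le_of_norm_deriv_le_segment_01'
    (fun t _ => (hasDerivAt_iteratedFDeriv_line hF hk x v m t).hasDerivWithinAt)
    (fun t ht => hC t (Set.Ico_subset_Icc_self ht))
  simpa using h

theorem abs_sub_taylor_two_le_of_hasDerivAt {g₀ g₁ g₂ g₃ : ℝ → ℝ}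
    (h₀ : ∀ t, HasDerivAt g₀ (g₁ t) t) (h₁ : ∀ t, HasDerivAt g₁ (g₂ t) t)
    (h₂ : ∀ t, HasDerivAt g₂ (g₃ t) t) {C : ℝ} (hC : ∀ t ∈ Set.Icc (0 : ℝ) 1, |g₃ t| ≤ C) :
    |g₀ 1 - g₀ 0 - g₁ 0 - g₂ 0 / 2| ≤ C := by
  have hC0 : 0 ≤ C := (abs_nonneg _).trans (hC 0 (by simp))
  -- The mean value inequality is applied three times, from g₂ up to g₀. Each factor t ≤ 1 is
  -- dropped, which gives C instead of C/6.
  have mvt : ∀ f f' : ℝ → ℝ, (∀ t, HasDerivAt f (f' t) t) →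
      (∀ t ∈ Set.Icc (0 : ℝ) 1, |f' t| ≤ C) → ∀ t ∈ Set.Icc (0 : ℝ) 1, |f t - f 0| ≤ C := by
    intro f f' hf hf' t ht
    have h := (convex_Icc (0 : ℝ) 1).norm_image_sub_le_of_norm_hasDerivWithin_le
      (fun s _ => (hf s).hasDerivWithinAt) hf' (Set.left_mem_Icc.2 zero_le_one) ht
    refine h.trans ?_
    rw [Real.norm_eq_abs, sub_zero, abs_of_nonneg ht.1]
    exact mul_le_of_le_one_right hC0 ht.2
  have b₂ := mvt g₂ g₃ h₂ hC
  have b₁ := mvt (fun s => g₁ s - s * g₂ 0) (fun s => g₂ s - g₂ 0)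
    (fun s => by simpa using (h₁ s).fun_sub ((hasDerivAt_id' s).mul_const (g₂ 0))) b₂
  have hsq : ∀ s, HasDerivAt (fun s : ℝ => s ^ 2 / 2 * g₂ 0) (s * g₂ 0) s := fun s => by
    refine (((hasDerivAt_id' s).fun_pow 2).div_const 2).mul_const (g₂ 0) |>.congr_deriv ?_
    norm_num
  have b₀ := mvt (fun s => g₀ s - s * g₁ 0 - s ^ 2 / 2 * g₂ 0) (fun s => g₁ s - g₁ 0 - s * g₂ 0)
    (fun s => by
      simpa using ((h₀ s).fun_sub ((hasDerivAt_id' s).mul_const (g₁ 0))).fun_sub (hsq s))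
    (fun t ht => by
      convert b₁ t ht using 2
      ring) 1 (Set.right_mem_Icc.2 zero_le_one)
  convert b₀ using 2
  ring

/-- Second order Taylor expansion with a bound on the remainder. -/
theorem abs_sub_taylor_two_le (hF : ContDiff ℝ n F) (hn : 2 < n) (x v : E) {C : ℝ}
    (hC : ∀ t ∈ Set.Icc (0 : ℝ) 1, |iteratedFDeriv ℝ 3 F (x + t • v) (fun _ => v)| ≤ C) :
    |F (x + v) - F x - fderiv ℝ F x v - iteratedFDeriv ℝ 2 F x (fun _ => v) / 2| ≤ C := by
  have hcons : ∀ k : ℕ, (Fin.cons v (fun _ : Fin k => v) : Fin (k + 1) → E) = fun _ => v :=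
    fun k => funext fun l => by cases l using Fin.cases <;> rfl
  have hd : ∀ (k : ℕ), k ≤ 2 → ∀ t : ℝ,
      HasDerivAt (fun s : ℝ => iteratedFDeriv ℝ k F (x + s • v) (fun _ => v))
        (iteratedFDeriv ℝ (k + 1) F (x + t • v) (fun _ => v)) t := fun k hk t => by
    have hk' : (k : WithTop ℕ∞) < n := lt_of_le_of_lt (by exact_mod_cast hk) hn
    simpa only [hcons] using hasDerivAt_iteratedFDeriv_line hF hk' x v (fun _ => v) t
  have h := abs_sub_taylor_two_le_of_hasDerivAt (hd 0 zero_le_two) (hd 1 one_le_two) (hd 2 le_rfl)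
    hC
  simpa [iteratedFDeriv_one_apply] using h

end Line

/-! ### The supremum of the directional derivatives -/

variable {F : Me M N → ℝ}

theorem xi_mem_switchDirs (i : Fin M) (j : Fin N) (m : Fin M) (n : Fin N) :
    xi i j m n ∈ switchDirs M N := ⟨i, j, m, n, rfl⟩

theorem finite_switchDirs (M N : ℕ) : (switchDirs M N).Finite := by
  have h : switchDirs M N =
      Set.range fun p : Fin M × Fin N × Fin M × Fin N => xi p.1 p.2.1 p.2.2.1 p.2.2.2 := by
    ext Y
    simp [switchDirs, eq_comm]
  rw [h]
  exact Set.finite_range _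

/-- A continuous function on a compact space: a cube times a finite set of directions. Without
boundedness the real supremum would be the default value 0 and would control nothing. -/
theorem bddAbove_supDeriv {k : ℕ} (hF : ContDiff ℝ 4 F) (hk : k ≤ 4) (X : Me M N) :
    BddAbove (Set.range fun p : (Fin k → Set.Icc (0 : ℝ) 1) × (Fin k → switchDirs M N) =>
      |iteratedFDeriv ℝ k F
        (X + (db : ℝ) ^ (-(1 / 2) : ℝ) • ∑ l, (p.1 l : ℝ) • (p.2 l : Me M N))
        (fun l => (p.2 l : Me M N))|) := by
  have : CompactSpace (switchDirs M N) :=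
    isCompact_iff_compactSpace.1 (finite_switchDirs M N).isCompact
  have hc : Continuous fun x => iteratedFDeriv ℝ k F x :=
    hF.continuous_iteratedFDeriv (by exact_mod_cast hk)
  have h1 : Continuous fun p : (Fin k → Set.Icc (0 : ℝ) 1) × (Fin k → switchDirs M N) =>
      X + (db : ℝ) ^ (-(1 / 2) : ℝ) • ∑ l, (p.1 l : ℝ) • (p.2 l : Me M N) := by fun_prop
  have h2 : Continuous fun p : (Fin k → Set.Icc (0 : ℝ) 1) × (Fin k → switchDirs M N) =>
      (fun l => (p.2 l : Me M N)) := by fun_prop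
  exact (isCompact_range ((hc.comp h1).eval h2).abs).bddAbove

theorem supDeriv_nonneg (k : ℕ) (X : Me M N) : 0 ≤ supDeriv db k F X :=
  Real.iSup_nonneg fun _ => abs_nonneg _

theorem abs_fderiv_le_supDeriv (hF : ContDiff ℝ 4 F) (X : Me M N) {Y : Me M N}
    (hY : Y ∈ switchDirs M N) : |fderiv ℝ F X Y| ≤ supDeriv db 1 F X := by
  have h := le_ciSup (bddAbove_supDeriv (db := db) hF (by norm_num : 1 ≤ 4) X)
    (fun _ => ⟨0, by simp⟩, fun _ => ⟨Y, hY⟩)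
  refine le_trans (le_of_eq ?_) h
  simp [iteratedFDeriv_one_apply]
  rfl

theorem abs_iteratedFDeriv_two_le_supDeriv (hF : ContDiff ℝ 4 F) (X : Me M N) {Y : Me M N}
    (hY : Y ∈ switchDirs M N) :
    |iteratedFDeriv ℝ 2 F X (fun _ => Y)| ≤ supDeriv db 2 F X := by
  have h := le_ciSup (bddAbove_supDeriv (db := db) hF (by norm_num : 2 ≤ 4) X)
    (fun _ => ⟨0, by simp⟩, fun _ => ⟨Y, hY⟩)
  refine le_trans (le_of_eq ?_) h
  simp

/-- Only the first θ is nonzero, so the base point moves along Y alone. Taking Z = Y serves the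
Taylor remainder, a general Z the variation of a second derivative. -/
theorem abs_iteratedFDeriv_three_le_supDeriv (hF : ContDiff ℝ 4 F) (X : Me M N) {Y Z : Me M N}
    (hY : Y ∈ switchDirs M N) (hZ : Z ∈ switchDirs M N) {t : ℝ} (ht : t ∈ Set.Icc (0 : ℝ) 1) :
    |iteratedFDeriv ℝ 3 F (X + t • (db : ℝ) ^ (-(1 / 2) : ℝ) • Y) (Fin.cons Y fun _ => Z)| ≤
      supDeriv db 3 F X := by
  have h := le_ciSup (bddAbove_supDeriv (db := db) hF (by norm_num : 3 ≤ 4) X)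
    (Fin.cons ⟨t, ht⟩ fun _ => ⟨0, by simp⟩, Fin.cons ⟨Y, hY⟩ fun _ => ⟨Z, hZ⟩)
  have hdir : (fun l => ((Fin.cons ⟨Y, hY⟩ fun _ => ⟨Z, hZ⟩ : Fin 3 → switchDirs M N) l : Me M N)) =
      Fin.cons Y fun _ => Z := funext fun l => by cases l using Fin.cases <;> rfl
  have hsum : ∑ l, ((Fin.cons ⟨t, ht⟩ fun _ => ⟨0, by simp⟩ : Fin 3 → Set.Icc (0 : ℝ) 1) l : ℝ) •
      ((Fin.cons ⟨Y, hY⟩ fun _ => ⟨Z, hZ⟩ : Fin 3 → switchDirs M N) l : Me M N) = t • Y := by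
    rw [Fin.sum_univ_succ]
    simp
  dsimp only at h
  rw [hdir, hsum, smul_comm] at h
  exact h

theorem abs_iteratedFDeriv_two_shift_sub_le (hF : ContDiff ℝ 4 F) (X : Me M N) {Y Z : Me M N}
    (hY : Y ∈ switchDirs M N) (hZ : Z ∈ switchDirs M N) :
    |iteratedFDeriv ℝ 2 F (X + (db : ℝ) ^ (-(1 / 2) : ℝ) • Y) (fun _ => Z) -
      iteratedFDeriv ℝ 2 F X (fun _ => Z)| ≤
      (db : ℝ) ^ (-(1 / 2) : ℝ) * supDeriv db 3 F X := by
  refine abs_iteratedFDeriv_add_sub_le hF (by norm_num) X _ _ fun t ht => ?_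
  have h := ContinuousMultilinearMap.cons_smul
    (iteratedFDeriv ℝ 3 F (X + t • (db : ℝ) ^ (-(1 / 2) : ℝ) • Y)) (fun _ => Z)
    ((db : ℝ) ^ (-(1 / 2) : ℝ)) Y
  rw [h, smul_eq_mul, abs_mul, abs_of_nonneg (by positivity)]
  exact mul_le_mul_of_nonneg_left (abs_iteratedFDeriv_three_le_supDeriv hF X hY hZ ht)
    (by positivity)

theorem abs_shift_sub_taylor_two_le (hF : ContDiff ℝ 4 F) (X : Me M N) {Y : Me M N}
    (hY : Y ∈ switchDirs M N) :
    |F (X + (db : ℝ) ^ (-(1 / 2) : ℝ) • Y) - F X - (db : ℝ) ^ (-(1 / 2) : ℝ) * fderiv ℝ F X Y -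
      ((db : ℝ) ^ (-(1 / 2) : ℝ)) ^ 2 / 2 * iteratedFDeriv ℝ 2 F X (fun _ => Y)| ≤
      ((db : ℝ) ^ (-(1 / 2) : ℝ)) ^ 3 * supDeriv db 3 F X := by
  set q := (db : ℝ) ^ (-(1 / 2) : ℝ) with hq
  have hq0 : 0 ≤ q := by positivity
  have hs : ∀ (k : ℕ) (x : Me M N), iteratedFDeriv ℝ k F x (fun _ => q • Y) =
      q ^ k * iteratedFDeriv ℝ k F x (fun _ => Y) := fun k x => by
    rw [ContinuousMultilinearMap.map_smul_univ]
    simp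
  have h := abs_sub_taylor_two_le hF (by norm_num) X (q • Y)
    (C := q ^ 3 * supDeriv db 3 F X) fun t ht => by
      rw [hs, abs_mul, abs_of_nonneg (by positivity)]
      refine mul_le_mul_of_nonneg_left ?_ (by positivity)
      have h3 := abs_iteratedFDeriv_three_le_supDeriv (db := db) hF X hY hY ht
      rwa [show (Fin.cons Y fun _ => Y : Fin 3 → Me M N) = fun _ => Y from
        funext fun l => by cases l using Fin.cases <;> rfl] at h3
  rwa [hs, map_smul, smul_eq_mul, mul_div_right_comm] at h

/-- The power mean inequality. -/
theorem unifE_le_rpow_mean {f : Graphs M N db dw → ℝ} (hf : ∀ A, 0 ≤ f A) {r : ℝ} (hr : 1 ≤ r) :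
    unifE f ≤ (unifE fun A => f A ^ r) ^ (1 / r) := by
  rcases isEmpty_or_nonempty (Graphs M N db dw) with hE | hE
  · simp only [unifE, Finset.univ_eq_empty, Finset.sum_empty, zero_div]
    exact Real.rpow_nonneg le_rfl _
  · have hc : (Fintype.card (Graphs M N db dw) : ℝ) ≠ 0 := by
      exact_mod_cast Fintype.card_ne_zero
    have h := Real.arith_mean_le_rpow_mean Finset.univ
      (fun _ : Graphs M N db dw => 1 / (Fintype.card (Graphs M N db dw) : ℝ)) f
      (fun _ _ => by positivity) (by simp [hc]) (fun A _ => hf A) hr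
    simpa only [unifE, Finset.sum_div, one_div_mul_eq_div] using h

theorem unifE_supDeriv_le {k : ℕ} (hk : k ∈ Finset.Icc 1 4) {r : ℝ} (hr : 1 ≤ r) :
    unifE (fun A : Graphs M N db dw => supDeriv db k F (normalized A)) ≤
      maxDerivSeminorm db dw r F :=
  (unifE_le_rpow_mean (fun _ => supDeriv_nonneg _ _) hr).trans
    (Finset.le_sup' (fun k => derivSeminorm db dw k r F) hk)

/-- The derivative of `F` in the direction `ξ_{ij}^{mn}`. -/
def switchDeriv (F : Me M N → ℝ) (X : Me M N) (i : Fin M) (j : Fin N) (m : Fin M) (n : Fin N) : ℝ :=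
  fderiv ℝ F X (xi i j m n)

/-- The second derivative of `F` in the direction `ξ_{ij}^{mn}`. -/
def switchDeriv₂ (F : Me M N → ℝ) (X : Me M N) (i : Fin M) (j : Fin N) (m : Fin M) (n : Fin N) :
    ℝ :=
  iteratedFDeriv ℝ 2 F X (fun _ => xi i j m n)

theorem abs_switchDeriv_le (hF : ContDiff ℝ 4 F) (X : Me M N)
    (i : Fin M) (j : Fin N) (m : Fin M) (n : Fin N) :
    |switchDeriv F X i j m n| ≤ supDeriv db 1 F X :=
  abs_fderiv_le_supDeriv hF X (xi_mem_switchDirs i j m n)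

theorem abs_switchDeriv₂_le (hF : ContDiff ℝ 4 F) (X : Me M N)
    (i : Fin M) (j : Fin N) (m : Fin M) (n : Fin N) :
    |switchDeriv₂ F X i j m n| ≤ supDeriv db 2 F X :=
  abs_iteratedFDeriv_two_le_supDeriv hF X (xi_mem_switchDirs i j m n)

theorem switchDeriv_swap_columns (X : Me M N) (i : Fin M) (j : Fin N) (m : Fin M) (n : Fin N) :
    switchDeriv F X i n m j = -switchDeriv F X i j m n := by
  rw [switchDeriv, switchDeriv, xi_swap_columns, map_neg]

theorem switchDeriv₂_swap_columns (X : Me M N) (i : Fin M) (j : Fin N) (m : Fin M) (n : Fin N) :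
    switchDeriv₂ F X i n m j = switchDeriv₂ F X i j m n := by
  have h : (fun _ : Fin 2 => xi i n m j) = fun _ => (-1 : ℝ) • xi i j m n :=
    funext fun _ => (xi_swap_columns i j m n).trans (neg_one_smul ℝ _).symm
  rw [switchDeriv₂, switchDeriv₂, h, ContinuousMultilinearMap.map_smul_univ]
  simp

theorem switchDeriv₂_swap_pairs (X : Me M N) (i : Fin M) (j : Fin N) (m : Fin M) (n : Fin N) :
    switchDeriv₂ F X m n i j = switchDeriv₂ F X i j m n := by
  rw [switchDeriv₂, switchDeriv₂, xi_swap_pairs]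

/-! ### First order terms -/

/-- With U = ∑ u_ij and V = ∑ A_ij u_ij, regularity reduces both sides to 2 d_w (N V - d_b U). This
identity is exact, so the drift contributes no error. -/
theorem sum_edge_pairs_mul {A : Matrix (Fin M) (Fin N) ℝ} (hA : IsBiregular db dw A)
    (hM : 0 < M) (u : Matrix (Fin M) (Fin N) ℝ) :
    ∑ i, ∑ j, ∑ m, ∑ n, A i j * A m n * (u i j + u m n - u i n - u m j) =
      dw / (2 * M) * ∑ i, ∑ j, ∑ m, ∑ n,
        (A i j + A m n - A i n - A m j) * (u i j + u m n - u i n - u m j) := by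
  have hM' : (M : ℝ) ≠ 0 := by positivity
  set U : ℝ := ∑ i, ∑ j, u i j with hU
  set V : ℝ := ∑ i, ∑ j, A i j * u i j with hV
  set f : Fin M → Fin N → Fin M → Fin N → ℝ := fun i j m n => u i j + u m n - u i n - u m j with hf
  have hUcol : ∑ j, ∑ i, u i j = U := Finset.sum_comm
  have e1 : ∑ i, ∑ j, ∑ m, ∑ n, A i j * f i j m n = M * N * V - M * db * U := by
    have h1 : ∑ i, ∑ j, ∑ m : Fin M, ∑ n : Fin N, A i j * u i j = M * N * V := by
      simp only [Finset.sum_const, Finset.card_univ, Fintype.card_fin, nsmul_eq_mul,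
        ← Finset.mul_sum, ← hV]
      ring
    have h2 : ∑ i, ∑ j, ∑ m, ∑ n, A i j * u m n = N * dw * U := by
      simp only [← Finset.mul_sum, ← Finset.sum_mul, hA.sum_edges, ← hU]
    have h3 : ∑ i, ∑ j, ∑ m : Fin M, ∑ n, A i j * u i n = M * db * U := by
      simp only [Finset.sum_const, Finset.card_univ, Fintype.card_fin, nsmul_eq_mul,
        ← Finset.mul_sum, ← Finset.sum_mul, hA.sum_row, ← hU]
      ring
    have h4 : ∑ i, ∑ j, ∑ m, ∑ n : Fin N, A i j * u m j = N * dw * U := by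
      rw [Finset.sum_comm]
      simp only [Finset.sum_const, Finset.card_univ, Fintype.card_fin, nsmul_eq_mul,
        ← Finset.mul_sum, ← Finset.sum_mul, hA.sum_col, hUcol]
      ring
    simp only [hf, mul_sub, mul_add, Finset.sum_sub_distrib, Finset.sum_add_distrib, h1, h2, h3, h4]
    ring
  have e2 : ∑ i, ∑ j, ∑ m, ∑ n, A m n * f i j m n = M * N * V - M * db * U := by
    rw [← e1, ← sum_four_swap_pairs]
    simp only [hf]
    refine Finset.sum_congr rfl fun i _ => Finset.sum_congr rfl fun j _ =>
      Finset.sum_congr rfl fun m _ => Finset.sum_congr rfl fun n _ => by ring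
  have e3 : ∑ i, ∑ j, ∑ m, ∑ n, A i n * f i j m n = -(M * N * V - M * db * U) := by
    rw [← e1, ← sum_four_swap_columns]
    simp only [hf, ← Finset.sum_neg_distrib]
    refine Finset.sum_congr rfl fun i _ => Finset.sum_congr rfl fun j _ =>
      Finset.sum_congr rfl fun m _ => Finset.sum_congr rfl fun n _ => by ring
  have e4 : ∑ i, ∑ j, ∑ m, ∑ n, A m j * f i j m n = -(M * N * V - M * db * U) := by
    rw [← e2, ← sum_four_swap_columns]
    simp only [hf, ← Finset.sum_neg_distrib]
    refine Finset.sum_congr rfl fun i _ => Finset.sum_congr rfl fun j _ =>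
      Finset.sum_congr rfl fun m _ => Finset.sum_congr rfl fun n _ => by ring
  have e5 : ∑ i, ∑ j, ∑ m, ∑ n, A i j * A m n * f i j m n =
      2 * (N * dw) * V - 2 * (db * dw) * U := by
    have h1 : ∑ i, ∑ j, ∑ m, ∑ n, A i j * A m n * u i j = N * dw * V := by
      simp only [mul_right_comm _ _ (u _ _), ← Finset.mul_sum, hA.sum_edges, ← Finset.sum_mul, ← hV]
      ring
    have h2 : ∑ i, ∑ j, ∑ m, ∑ n, A i j * A m n * u m n = N * dw * V := by
      simp only [mul_assoc, ← Finset.mul_sum, ← Finset.sum_mul, hA.sum_edges, ← hV]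
    have h3 : ∀ i, ∑ j, ∑ m, ∑ n, A i j * A m n * u i n = db * dw * ∑ n, u i n := fun i => by
      have : ∀ j, ∑ m, ∑ n, A i j * A m n * u i n = A i j * (dw * ∑ n, u i n) := fun j => by
        rw [Finset.sum_comm]
        simp only [mul_assoc, ← Finset.mul_sum, ← Finset.sum_mul, hA.sum_col]
      simp only [this]
      rw [← Finset.sum_mul, hA.sum_row, mul_assoc]
    have h4 : ∑ i, ∑ j, ∑ m, ∑ n, A i j * A m n * u m j = db * dw * U := by
      rw [Finset.sum_comm]
      simp only [mul_right_comm _ _ (u _ _), ← Finset.mul_sum, hA.sum_row]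
      simp only [mul_assoc, ← Finset.mul_sum, ← Finset.sum_mul, hA.sum_col]
      simp only [hUcol]
      ring
    simp only [hf, mul_sub, mul_add, Finset.sum_sub_distrib, Finset.sum_add_distrib, h1, h2, h3, h4]
    simp only [← Finset.mul_sum, ← hU]
    ring
  have e6 : ∑ i, ∑ j, ∑ m, ∑ n, (A i j + A m n - A i n - A m j) * f i j m n =
      4 * (M * N * V - M * db * U) := by
    simp only [sub_mul, add_mul, Finset.sum_sub_distrib, Finset.sum_add_distrib, e1, e2, e3, e4]
    ring
  rw [e5, e6]
  field_simp
  ring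

theorem sum_edge_pairs_mul_switchDeriv (A : Graphs M N db dw) (hM : 0 < M) (hN : 0 < N)
    (X : Me M N) :
    ∑ i, ∑ j, ∑ m, ∑ n, A.1 i j * A.1 m n * switchDeriv F X i j m n =
      dw / (2 * M) * ∑ i, ∑ j, ∑ m, ∑ n,
        (A.1 i j + A.1 m n - A.1 i n - A.1 m j) * switchDeriv F X i j m n := by
  have h := sum_edge_pairs_mul A.2 hM (fun i j => switchDeriv F X i j ⟨0, hM⟩ ⟨0, hN⟩)
  have hu : ∀ i j m n, switchDeriv F X i j m n =
      switchDeriv F X i j ⟨0, hM⟩ ⟨0, hN⟩ + switchDeriv F X m n ⟨0, hM⟩ ⟨0, hN⟩ -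
        switchDeriv F X i n ⟨0, hM⟩ ⟨0, hN⟩ - switchDeriv F X m j ⟨0, hM⟩ ⟨0, hN⟩ := by
    intro i j m n
    unfold switchDeriv
    rw [xi_eq_add_sub ⟨0, hM⟩ ⟨0, hN⟩ i j m n, map_sub, map_sub, map_add]
  simpa only [← hu] using h

/-! ### Expansion of the generator -/

/-- The generator of the switching dynamics, expanded to second order. -/
theorem abs_genQ_sub_le (hF : ContDiff ℝ 4 F) (A : Graphs M N db dw) :
    |(∑ i, ∑ j, ∑ m, ∑ n, indI A.1 i j m n * (fF db dw F (switch A i j m n) - fF db dw F A)) -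
      (((db : ℝ) ^ (-(1 / 2) : ℝ)) ^ 2 / 2 *
          (∑ i, ∑ j, ∑ m, ∑ n, indI A.1 i j m n * switchDeriv₂ F (normalized A) i j m n) -
        (db : ℝ) ^ (-(1 / 2) : ℝ) *
          ∑ i, ∑ j, ∑ m, ∑ n, indI A.1 i j m n * switchDeriv F (normalized A) i j m n)| ≤
      ((N : ℝ) * dw) ^ 2 * (((db : ℝ) ^ (-(1 / 2) : ℝ)) ^ 3 * supDeriv db 3 F (normalized A)) := by
  set q := (db : ℝ) ^ (-(1 / 2) : ℝ) with hq
  have hq0 : 0 ≤ q := by positivity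
  simp only [Finset.mul_sum, ← Finset.sum_sub_distrib]
  have hS := supDeriv_nonneg (db := db) (F := F) 3 (normalized A)
  calc _ ≤ ∑ i, ∑ j, ∑ m, ∑ n, indI A.1 i j m n * (q ^ 3 * supDeriv db 3 F (normalized A)) := by
        refine abs_sum_four_le fun i j m n => ?_
        by_cases hI : indI A.1 i j m n = 0
        · simp [hI]
        -- The jump is along `xi i n m j`, the negative of `xi i j m n`: this flips the sign of the
        -- first order term and leaves the second order one.
        have h := abs_shift_sub_taylor_two_le (db := db) hF (normalized A)
          (xi_mem_switchDirs i n m j)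
        have h1 := switchDeriv_swap_columns (F := F) (normalized A) i j m n
        have h2 := switchDeriv₂_swap_columns (F := F) (normalized A) i j m n
        unfold switchDeriv at h1
        unfold switchDeriv₂ at h2
        rw [h1, h2, ← hq] at h
        unfold fF
        rw [normalized_switch A hI, ← hq]
        unfold switchDeriv switchDeriv₂
        calc _ = |indI A.1 i j m n * (F (normalized A + q • xi i n m j) - F (normalized A) -
              q * -(fderiv ℝ F (normalized A)) (xi i j m n) -
              q ^ 2 / 2 * iteratedFDeriv ℝ 2 F (normalized A) fun _ => xi i j m n)| := by
              congr 1
              ring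
          _ ≤ _ := by
              rw [abs_mul, abs_of_nonneg (A.2.indI_nonneg i j m n)]
              exact mul_le_mul_of_nonneg_left h (A.2.indI_nonneg i j m n)
    _ = (∑ i, ∑ j, ∑ m, ∑ n, indI A.1 i j m n) * (q ^ 3 * supDeriv db 3 F (normalized A)) := by
        simp only [← Finset.sum_mul]
    _ ≤ _ := mul_le_mul_of_nonneg_right A.2.sum_indI_le (by positivity)

/-! ### Averaging the centred second order term -/

/-- The average of `switchDeriv₂` against the edges of the graph and its density. -/
def edgeDeriv₂ (F : Me M N → ℝ) (A : Graphs M N db dw) (i : Fin M) (j : Fin N) : ℝ :=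
  ∑ m, ∑ n, (A.1 m n + (db : ℝ) / N) * switchDeriv₂ F (normalized A) i j m n

/-- With p = d_b/N, (A_ij - p)(A_mn + p) = A_ij A_mn - p² + p(A_ij - A_mn). The last term is
antisymmetric under exchanging (i,j) and (m,n), while the second derivative is symmetric, so it sums
to zero. -/
theorem sum_centered_mul_edgeDeriv₂ (A : Graphs M N db dw) :
    ∑ i, ∑ j, (A.1 i j - (db : ℝ) / N) * edgeDeriv₂ F A i j =
      (∑ i, ∑ j, ∑ m, ∑ n, A.1 i j * A.1 m n * switchDeriv₂ F (normalized A) i j m n) -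
        ((db : ℝ) / N) ^ 2 * ∑ i, ∑ j, ∑ m, ∑ n, switchDeriv₂ F (normalized A) i j m n := by
  have h1 : ∑ i, ∑ j, ∑ m, ∑ n, (db : ℝ) / N * (A.1 i j * switchDeriv₂ F (normalized A) i j m n) =
      ∑ i, ∑ j, ∑ m, ∑ n, (db : ℝ) / N * (A.1 m n * switchDeriv₂ F (normalized A) i j m n) := by
    rw [← sum_four_swap_pairs]
    simp only [switchDeriv₂_swap_pairs]
  have h2 : ∀ i j m n, (A.1 i j - (db : ℝ) / N) *
      ((A.1 m n + (db : ℝ) / N) * switchDeriv₂ F (normalized A) i j m n) =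
      A.1 i j * A.1 m n * switchDeriv₂ F (normalized A) i j m n -
        ((db : ℝ) / N) ^ 2 * switchDeriv₂ F (normalized A) i j m n +
        (db : ℝ) / N * (A.1 i j * switchDeriv₂ F (normalized A) i j m n) -
        (db : ℝ) / N * (A.1 m n * switchDeriv₂ F (normalized A) i j m n) := fun i j m n => by ring
  unfold edgeDeriv₂
  simp only [Finset.mul_sum, h2, Finset.sum_sub_distrib, Finset.sum_add_distrib, h1]
  ring

theorem sum_edge_add_density (A : Graphs M N db dw) (hN : 0 < N) :
    ∑ m, ∑ n, (A.1 m n + (db : ℝ) / N) = 2 * (N * dw) := by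
  have hN' : (N : ℝ) ≠ 0 := by positivity
  simp only [Finset.sum_add_distrib, A.2.sum_edges, Finset.sum_const, Finset.card_univ,
    Fintype.card_fin, nsmul_eq_mul, mul_div_cancel₀ _ hN', double_count A]
  ring

theorem edge_add_density_nonneg (A : Graphs M N db dw) (m : Fin M) (n : Fin N) :
    0 ≤ A.1 m n + (db : ℝ) / N := add_nonneg (A.2.nonneg m n) (by positivity)

theorem abs_sum_sum_le {f g : Fin M → Fin N → ℝ} (h : ∀ i j, |f i j| ≤ g i j) :
    |∑ i, ∑ j, f i j| ≤ ∑ i, ∑ j, g i j :=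
  (Finset.abs_sum_le_sum_abs _ _).trans (Finset.sum_le_sum fun i _ =>
    (Finset.abs_sum_le_sum_abs _ _).trans (Finset.sum_le_sum fun j _ => h i j))

theorem abs_edgeDeriv₂_le (hF : ContDiff ℝ 4 F) (A : Graphs M N db dw) (hN : 0 < N)
    (i : Fin M) (j : Fin N) :
    |edgeDeriv₂ F A i j| ≤ 2 * (N * dw) * supDeriv db 2 F (normalized A) := by
  rw [← sum_edge_add_density A hN]
  simp only [Finset.sum_mul]
  refine abs_sum_sum_le fun m n => ?_
  rw [abs_mul, abs_of_nonneg (edge_add_density_nonneg A m n)]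
  exact mul_le_mul_of_nonneg_left (abs_switchDeriv₂_le hF _ i j m n) (edge_add_density_nonneg A m n)

/-- The function `edgeDeriv₂` changes little under a switching. -/
theorem abs_edgeDeriv₂_switch_sub_le (hF : ContDiff ℝ 4 F) (A : Graphs M N db dw) (hN : 0 < N)
    (i : Fin M) (j : Fin N) {k : Fin M} {l : Fin N} {m : Fin M} {n : Fin N}
    (hI : indI A.1 k l m n ≠ 0) :
    |edgeDeriv₂ F (switch A k l m n) i j - edgeDeriv₂ F A i j| ≤
      4 * supDeriv db 2 F (normalized A) +
        2 * (N * dw) * ((db : ℝ) ^ (-(1 / 2) : ℝ) * supDeriv db 3 F (normalized A)) := by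
  set q := (db : ℝ) ^ (-(1 / 2) : ℝ) with hq
  set B := switch A k l m n with hB
  set s : Fin M → Fin N → Matrix (Fin M) (Fin N) ℝ := fun a b => Matrix.single a b 1 with hs
  have hs1 : ∀ a b, ∑ x, ∑ y, s a b x y = 1 := fun a b => by
    simp [hs, Matrix.single_apply, ite_and]
  have hs0 : ∀ a b x y, 0 ≤ s a b x y := fun a b x y => by
    simp only [hs, Matrix.single_apply]
    split_ifs <;> norm_num
  -- A switching alters at most four entries, each by a matrix unit; this is the 4 in front of the
  -- second derivative.
  have h4 : ∑ x, ∑ y, (s k l x y + s m n x y + s k n x y + s m l x y) = 4 := by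
    simp only [Finset.sum_add_distrib, hs1]
    norm_num
  rw [← sum_edge_add_density B hN, ← h4]
  unfold edgeDeriv₂
  simp only [Finset.sum_mul, ← Finset.sum_sub_distrib, ← Finset.sum_add_distrib]
  refine abs_sum_sum_le fun x y => ?_
  have hdiff : B.1 x y - A.1 x y = -(s k l x y + s m n x y - s k n x y - s m l x y) := by
    rw [hB, switch_val A hI]
    simp only [xiBlock, hs, Matrix.sub_apply, Matrix.add_apply]
    ring
  have hdiff' : |B.1 x y - A.1 x y| ≤ s k l x y + s m n x y + s k n x y + s m l x y := by
    rw [hdiff, abs_le]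
    constructor <;> linarith [hs0 k l x y, hs0 m n x y, hs0 k n x y, hs0 m l x y]
  have hshift : |switchDeriv₂ F (normalized B) i j x y - switchDeriv₂ F (normalized A) i j x y| ≤
      q * supDeriv db 3 F (normalized A) := by
    rw [hB, normalized_switch A hI]
    exact abs_iteratedFDeriv_two_shift_sub_le hF _ (xi_mem_switchDirs _ _ _ _)
      (xi_mem_switchDirs _ _ _ _)
  -- Discrete product rule: the change of the weight uses the old derivative, the change of the
  -- derivative uses the new weight, whose total is again 2 N d_w.
  calc _ = |(B.1 x y - A.1 x y) * switchDeriv₂ F (normalized A) i j x y +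
        (B.1 x y + (db : ℝ) / N) * (switchDeriv₂ F (normalized B) i j x y -
          switchDeriv₂ F (normalized A) i j x y)| := by
        congr 1
        ring
    _ ≤ _ := by
        refine (abs_add_le _ _).trans (add_le_add ?_ ?_)
        · rw [abs_mul]
          exact mul_le_mul hdiff' (abs_switchDeriv₂_le hF _ i j x y) (abs_nonneg _)
            ((abs_nonneg _).trans hdiff')
        · rw [abs_mul, abs_of_nonneg (edge_add_density_nonneg B x y)]
          exact mul_le_mul_of_nonneg_left hshift (edge_add_density_nonneg B x y)

/-- By `sum_indI_sub_indI` the leftover at (i,j) is A_ij d_b d_w minus the path count. Both are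
nonnegative with the same total N d_w · d_b d_w, hence the factor 2. -/
theorem abs_sum_centered_mul_sub_le {A : Matrix (Fin M) (Fin N) ℝ} (hA : IsBiregular db dw A)
    (hN : 0 < N) (K : Fin M → Fin N → ℝ) {S : ℝ} (hK : ∀ i j, |K i j| ≤ S) :
    |N * dw * (∑ i, ∑ j, (A i j - (db : ℝ) / N) * K i j) -
      ∑ i, ∑ j, ∑ m, ∑ n, (indI A i j m n - indI A i n m j) * K i j| ≤
      2 * (N * dw * (db * dw)) * S := by
  have hN' : (N : ℝ) ≠ 0 := by positivity
  have h2 : 2 * (N * dw * (db * dw)) * S =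
      ∑ i, ∑ j, (A i j * (db * dw) + IsBiregular.pathCount A i j) * S := by
    simp only [← Finset.sum_mul, Finset.sum_add_distrib, hA.sum_pathCount]
    simp only [hA.sum_edges]
    ring
  simp only [← Finset.sum_mul, hA.sum_indI_sub_indI, Finset.mul_sum, ← Finset.sum_sub_distrib]
  rw [h2]
  refine abs_sum_sum_le fun i j => ?_
  have h1 : N * dw * ((A i j - (db : ℝ) / N) * K i j) -
      (N * dw * A i j - db * dw - A i j * (db * dw) + IsBiregular.pathCount A i j) * K i j =
      (A i j * (db * dw) - IsBiregular.pathCount A i j) * K i j := by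
    field_simp
    ring
  have h3 : 0 ≤ A i j * (db * dw) := mul_nonneg (hA.nonneg i j) (by positivity)
  have h4 := hA.pathCount_nonneg i j
  rw [h1, abs_mul]
  refine mul_le_mul ?_ (hK i j) (abs_nonneg _) (by positivity)
  rw [abs_le]
  constructor <;> linarith

/-- Integration by parts: the centred edge variables average out against `edgeDeriv₂`. -/
theorem abs_sum_graphs_indI_sub_mul_le (hF : ContDiff ℝ 4 F) (hN : 0 < N) :
    |∑ A : Graphs M N db dw, ∑ i, ∑ j, ∑ m, ∑ n,
      (indI A.1 i j m n - indI A.1 i n m j) * edgeDeriv₂ F A i j| ≤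
      ∑ A : Graphs M N db dw, ((N : ℝ) * dw) ^ 2 * (4 * supDeriv db 2 F (normalized A) +
        2 * (N * dw) * ((db : ℝ) ^ (-(1 / 2) : ℝ) * supDeriv db 3 F (normalized A))) := by
  -- Detailed balance, for each fixed quadruple, replaces the reverse weight by the forward weight
  -- with the function evaluated at the switched graph.
  have h1 : ∑ A : Graphs M N db dw, ∑ i, ∑ j, ∑ m, ∑ n,
      (indI A.1 i j m n - indI A.1 i n m j) * edgeDeriv₂ F A i j =
      ∑ A : Graphs M N db dw, ∑ i, ∑ j, ∑ m, ∑ n,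
        indI A.1 i j m n * (edgeDeriv₂ F A i j - edgeDeriv₂ F (switch A i j m n) i j) := by
    rw [sum_graphs_comm, sum_graphs_comm]
    refine Finset.sum_congr rfl fun i _ => Finset.sum_congr rfl fun j _ =>
      Finset.sum_congr rfl fun m _ => Finset.sum_congr rfl fun n _ => ?_
    simp only [sub_mul, mul_sub, Finset.sum_sub_distrib]
    rw [sum_indI_mul_switch i j m n fun A => edgeDeriv₂ F A i j]
  rw [h1]
  refine (Finset.abs_sum_le_sum_abs _ _).trans (Finset.sum_le_sum fun A _ => ?_)
  have hS2 := supDeriv_nonneg (db := db) (F := F) 2 (normalized A)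
  have hS3 := supDeriv_nonneg (db := db) (F := F) 3 (normalized A)
  refine le_trans ?_ (mul_le_mul_of_nonneg_right A.2.sum_indI_le (by positivity))
  simp only [Finset.sum_mul]
  refine abs_sum_four_le fun i j m n => ?_
  by_cases hI : indI A.1 i j m n = 0
  · simp [hI]
  rw [abs_mul, abs_of_nonneg (A.2.indI_nonneg i j m n), abs_sub_comm]
  exact mul_le_mul_of_nonneg_left (abs_edgeDeriv₂_switch_sub_le hF A hN i j hI)
    (A.2.indI_nonneg i j m n)

/-! ### Comparison of the two generators -/

theorem rpow_neg_half_sq_mul {d : ℕ} (hd : 0 < d) : ((d : ℝ) ^ (-(1 / 2) : ℝ)) ^ 2 * d = 1 := by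
  have hd' : (0 : ℝ) < d := by exact_mod_cast hd
  rw [← Real.rpow_natCast, ← Real.rpow_mul hd'.le]
  norm_num [Real.rpow_neg_one, hd'.ne']

/-- The drift term of the Ornstein–Uhlenbeck generator. -/
theorem drift_eq (A : Graphs M N db dw) (hM : 0 < M) (hN : 0 < N) (hw : 0 < dw) :
    1 / (16 * (M : ℝ) * (N : ℝ)) * (∑ i : Fin M, ∑ j : Fin N, ∑ m : Fin M, ∑ n : Fin N,
        Matrix.trace ((xi i j m n).1 * (normalized A).1) *
          fderiv ℝ F (normalized A) (xi i j m n)) =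
      1 / (4 * (N : ℝ) * dw) * ((db : ℝ) ^ (-(1 / 2) : ℝ) *
        ∑ i, ∑ j, ∑ m, ∑ n, A.1 i j * A.1 m n * switchDeriv F (normalized A) i j m n) := by
  have hM' : (M : ℝ) ≠ 0 := by positivity
  have hN' : (N : ℝ) ≠ 0 := by positivity
  have hw' : (dw : ℝ) ≠ 0 := by positivity
  rw [sum_edge_pairs_mul_switchDeriv A hM hN]
  simp only [trace_xi_mul_normalized, mul_assoc, ← Finset.mul_sum, switchDeriv]
  field_simp
  ring

/-- The difference of the two generators, up to the centred second order term. -/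
theorem abs_genQ_sub_genL_sub_le (hF : ContDiff ℝ 4 F) (A : Graphs M N db dw) (hM : 0 < M)
    (hN : 0 < N) (hd : 0 < db) (hw : 0 < dw) :
    |genQ (fF db dw F) A - genL F (normalized A) -
      1 / (8 * (N : ℝ) * dw * db) * ∑ i, ∑ j, (A.1 i j - (db : ℝ) / N) * edgeDeriv₂ F A i j| ≤
      (db : ℝ) ^ (-(1 / 2) : ℝ) * db * dw / 2 * supDeriv db 1 F (normalized A) +
      dw / 4 * supDeriv db 2 F (normalized A) +
      M * (db : ℝ) ^ (-(1 / 2) : ℝ) / 4 * supDeriv db 3 F (normalized A) := by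
  have hM' : (0 : ℝ) < M := by positivity
  have hN' : (0 : ℝ) < N := by positivity
  have hw' : (0 : ℝ) < dw := by positivity
  have hd' : (0 : ℝ) < db := by positivity
  have hMN := double_count A
  have h0 := abs_genQ_sub_le hF A
  have h1 := A.2.abs_sum_indI_mul_sub_le _ (abs_switchDeriv_le (db := db) hF (normalized A))
  have h2 := A.2.abs_sum_indI_mul_sub_le _ (abs_switchDeriv₂_le (db := db) hF (normalized A))
  have h3 := sum_centered_mul_edgeDeriv₂ (F := F) A
  have h4 := drift_eq (F := F) A hM hN hw
  have hq2 := rpow_neg_half_sq_mul hd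
  have hq0 : 0 < (db : ℝ) ^ (-(1 / 2) : ℝ) := by positivity
  unfold genQ genL
  rw [h4, h3]
  set q := (db : ℝ) ^ (-(1 / 2) : ℝ) with hq
  set S1 := supDeriv db 1 F (normalized A)
  set S2 := supDeriv db 2 F (normalized A)
  set S3 := supDeriv db 3 F (normalized A)
  set T0 := ∑ i, ∑ j, ∑ m, ∑ n, indI A.1 i j m n * (fF db dw F (switch A i j m n) - fF db dw F A)
  set T1 := ∑ i, ∑ j, ∑ m, ∑ n, indI A.1 i j m n * switchDeriv F (normalized A) i j m n
  set T2 := ∑ i, ∑ j, ∑ m, ∑ n, indI A.1 i j m n * switchDeriv₂ F (normalized A) i j m n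
  set U1 := ∑ i, ∑ j, ∑ m, ∑ n, A.1 i j * A.1 m n * switchDeriv F (normalized A) i j m n
  set U2 := ∑ i, ∑ j, ∑ m, ∑ n, A.1 i j * A.1 m n * switchDeriv₂ F (normalized A) i j m n
  change |1 / (4 * (N : ℝ) * dw) * T0 - (1 / (8 * (M : ℝ) * (N : ℝ) ^ 2) *
    (∑ i, ∑ j, ∑ m, ∑ n, switchDeriv₂ F (normalized A) i j m n) - _) - _| ≤ _
  set V := ∑ i, ∑ j, ∑ m, ∑ n, switchDeriv₂ F (normalized A) i j m n
  -- Double counting M d_b = N d_w makes the diffusion constant agree with the jump rate when A_ij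
  -- A_mn is replaced by (d_b/N)².
  have hV : 1 / (8 * (M : ℝ) * (N : ℝ) ^ 2) = 1 / (8 * (N : ℝ) * dw * db) * ((db : ℝ) / N) ^ 2 := by
    field_simp
    linear_combination -hMN
  have hU : 1 / (8 * (N : ℝ) * dw * db) = 1 / (4 * (N : ℝ) * dw) * (q ^ 2 / 2) := by
    rw [eq_div_of_mul_eq hd'.ne' hq2]
    field_simp
    norm_num
  have hdecomp : 1 / (4 * (N : ℝ) * dw) * T0 - (1 / (8 * (M : ℝ) * (N : ℝ) ^ 2) * V -
      1 / (4 * (N : ℝ) * dw) * (q * U1)) -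
      1 / (8 * (N : ℝ) * dw * db) * (U2 - ((db : ℝ) / N) ^ 2 * V) =
      1 / (4 * (N : ℝ) * dw) * ((T0 - (q ^ 2 / 2 * T2 - q * T1)) - q * (T1 - U1) +
        q ^ 2 / 2 * (T2 - U2)) := by
    rw [hV, hU]
    ring
  have hbound : |(T0 - (q ^ 2 / 2 * T2 - q * T1)) - q * (T1 - U1) + q ^ 2 / 2 * (T2 - U2)| ≤
      ((N : ℝ) * dw) ^ 2 * (q ^ 3 * S3) + q * (2 * (N * dw * (db * dw)) * S1) +
        q ^ 2 / 2 * (2 * (N * dw * (db * dw)) * S2) := by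
    refine (abs_add_le _ _).trans (add_le_add ((abs_sub _ _).trans (add_le_add h0 ?_)) ?_)
    · rw [abs_mul, abs_of_nonneg hq0.le]
      exact mul_le_mul_of_nonneg_left h1 hq0.le
    · rw [abs_mul, abs_of_nonneg (by positivity)]
      exact mul_le_mul_of_nonneg_left h2 (by positivity)
  rw [hdecomp, abs_mul, abs_of_nonneg (by positivity)]
  refine (mul_le_mul_of_nonneg_left hbound (by positivity)).trans (le_of_eq ?_)
  have hNw : (N : ℝ) * dw * q ^ 2 = M := by
    rw [← hMN]
    linear_combination (M : ℝ) * hq2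
  field_simp
  linear_combination 2 * (q * S3 * hNw + dw * S2 * hq2)

/-- The centred second order term is small on average. -/
theorem abs_sum_graphs_centered_mul_le (hF : ContDiff ℝ 4 F) (hM : 0 < M)
    (hN : 0 < N) (hd : 0 < db) (hw : 0 < dw) :
    |∑ A : Graphs M N db dw,
      1 / (8 * (N : ℝ) * dw * db) * ∑ i, ∑ j, (A.1 i j - (db : ℝ) / N) * edgeDeriv₂ F A i j| ≤
      ∑ A : Graphs M N db dw, ((dw / 2 + 1 / (2 * db)) * supDeriv db 2 F (normalized A) +
        M * (db : ℝ) ^ (-(1 / 2) : ℝ) / 4 * supDeriv db 3 F (normalized A)) := by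
  have hM' : (0 : ℝ) < M := by positivity
  have hN' : (0 : ℝ) < N := by positivity
  have hw' : (0 : ℝ) < dw := by positivity
  have hd' : (0 : ℝ) < db := by positivity
  have h1 := abs_sum_graphs_indI_sub_mul_le (db := db) (dw := dw) hF hN
  set q := (db : ℝ) ^ (-(1 / 2) : ℝ) with hq
  set P : Graphs M N db dw → ℝ := fun A =>
    ∑ i, ∑ j, (A.1 i j - (db : ℝ) / N) * edgeDeriv₂ F A i j with hP
  set Q : Graphs M N db dw → ℝ := fun A => ∑ i, ∑ j, ∑ m, ∑ n,
    (indI A.1 i j m n - indI A.1 i n m j) * edgeDeriv₂ F A i j with hQ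
  have h2 : ∀ A : Graphs M N db dw, |N * dw * P A - Q A| ≤
      2 * (N * dw * (db * dw)) * (2 * (N * dw) * supDeriv db 2 F (normalized A)) := fun A =>
    abs_sum_centered_mul_sub_le A.2 hN _ (abs_edgeDeriv₂_le hF A hN)
  have h3 : ∑ A, 1 / (8 * (N : ℝ) * dw * db) * P A =
      1 / (8 * (N : ℝ) * dw * db * (N * dw)) * (∑ A, (N * dw * P A - Q A) + ∑ A, Q A) := by
    rw [← Finset.sum_add_distrib]
    simp only [sub_add_cancel, ← Finset.mul_sum]
    field_simp
  change |∑ A, 1 / (8 * (N : ℝ) * dw * db) * P A| ≤ _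
  rw [h3, abs_mul, abs_of_nonneg (by positivity)]
  refine (mul_le_mul_of_nonneg_left ((abs_add_le _ _).trans (add_le_add
    ((Finset.abs_sum_le_sum_abs _ _).trans (Finset.sum_le_sum fun A _ => h2 A)) h1))
    (by positivity)).trans (le_of_eq ?_)
  rw [← Finset.sum_add_distrib, Finset.mul_sum]
  refine Finset.sum_congr rfl fun A _ => ?_
  have hMN : (M : ℝ) = N * dw / db := by
    rw [eq_div_iff hd'.ne']
    exact double_count A
  rw [hMN]
  field_simp
  ring

theorem abs_unifE_genQ_sub_genL_le (hF : ContDiff ℝ 4 F) (hM : 0 < M)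
    (hN : 0 < N) (hd : 0 < db) (hw : 0 < dw) :
    |unifE fun A : Graphs M N db dw => genQ (fF db dw F) A - genL F (normalized A)| ≤
      (db : ℝ) ^ (-(1 / 2) : ℝ) * db * dw / 2 *
        unifE (fun A : Graphs M N db dw => supDeriv db 1 F (normalized A)) +
      (3 * dw / 4 + 1 / (2 * db)) *
        unifE (fun A : Graphs M N db dw => supDeriv db 2 F (normalized A)) +
      M * (db : ℝ) ^ (-(1 / 2) : ℝ) / 2 *
        unifE (fun A : Graphs M N db dw => supDeriv db 3 F (normalized A)) := by
  set q := (db : ℝ) ^ (-(1 / 2) : ℝ) with hq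
  have h1 := abs_sum_graphs_centered_mul_le (db := db) (dw := dw) hF hM hN hd hw
  set P : Graphs M N db dw → ℝ := fun A =>
    1 / (8 * (N : ℝ) * dw * db) * ∑ i, ∑ j, (A.1 i j - (db : ℝ) / N) * edgeDeriv₂ F A i j with hP
  set R : Graphs M N db dw → ℝ := fun A => genQ (fF db dw F) A - genL F (normalized A) with hR
  have h2 : |∑ A, (R A - P A)| ≤ _ := (Finset.abs_sum_le_sum_abs _ _).trans
    (Finset.sum_le_sum fun A _ => abs_genQ_sub_genL_sub_le hF A hM hN hd hw)
  have h3 : |∑ A, R A| ≤ |∑ A, (R A - P A)| + |∑ A, P A| := by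
    refine le_trans (le_of_eq ?_) (abs_add_le _ _)
    rw [← Finset.sum_add_distrib]
    simp only [sub_add_cancel]
  have h4 := h3.trans (add_le_add h2 h1)
  unfold unifE
  rw [abs_div, Nat.abs_cast]
  refine (div_le_div_of_nonneg_right h4 (Nat.cast_nonneg _)).trans (le_of_eq ?_)
  simp only [Finset.sum_add_distrib, ← Finset.mul_sum]
  ring

/-! ### The error in terms of the sparsity parameter -/

theorem inv_sqrt_le_sparsity (hN : 0 < N) (hd : 0 < db) :
    (db : ℝ) ^ (-(1 / 2) : ℝ) ≤ sparsity N db ^ (-(1 / 2) : ℝ) :=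
  Real.rpow_le_rpow_of_nonpos (lt_min (by positivity) (by positivity)) (min_le_left _ _)
    (by norm_num)

/-- The left side divided by N is exactly (N²/d_b³)^{-1/2}, and D is at most N²/d_b³. -/
theorem rpow_mul_sq_le_sparsity (hN : 0 < N) (hd : 0 < db) :
    (db : ℝ) ^ (-(1 / 2) : ℝ) * (db : ℝ) ^ 2 ≤ sparsity N db ^ (-(1 / 2) : ℝ) * N := by
  have hN' : (0 : ℝ) < N := by positivity
  have hd' : (0 : ℝ) < db := by positivity
  have h : ((N : ℝ) ^ 2 / (db : ℝ) ^ 3) ^ (-(1 / 2) : ℝ) ≤ sparsity N db ^ (-(1 / 2) : ℝ) :=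
    Real.rpow_le_rpow_of_nonpos (lt_min (by positivity) (by positivity)) (min_le_right _ _)
      (by norm_num)
  have h2 : (N : ℝ) ^ 2 / (db : ℝ) ^ 3 =
      ((db : ℝ) ^ (-(1 / 2) : ℝ) * (db : ℝ) ^ 2 / N) ^ (-2 : ℝ) := by
    rw [Real.rpow_neg (by positivity), Real.rpow_two, div_pow, inv_div, mul_pow]
    congr 1
    linear_combination -(db : ℝ) ^ 3 * rpow_neg_half_sq_mul hd
  rw [h2, ← Real.rpow_mul (by positivity)] at h
  norm_num at h
  rw [div_le_iff₀ hN'] at h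
  convert h using 3

end SwitchingDBM

end

/-! ### Conclusion -/

theorem mainTheorem3 (ε : ℝ) (hε : 0 < ε) :
    ∃ r₀ : ℝ, 1 ≤ r₀ ∧
      ∀ γ : ℝ, 0 < γ → ∀ α₀ : ℝ, 1 ≤ α₀ →
        ∃ C : ℝ, 0 < C ∧
          ∀ M N db dw : ℕ, 0 < N → N ≤ M → (M : ℝ) ≤ α₀ * N → M * db = N * dw →
            (N : ℝ) ^ γ ≤ (db : ℝ) → (db : ℝ) ≤ (N : ℝ) ^ (2 / 3 - γ) →
            ∀ r : ℝ, r₀ ≤ r → ∀ F : SwitchingDBM.Me M N → ℝ, ContDiff ℝ 4 F →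
              ∃ R : SwitchingDBM.Graphs M N db dw → ℝ,
                (∀ A : SwitchingDBM.Graphs M N db dw,
                  SwitchingDBM.genQ (SwitchingDBM.fF db dw F) A =
                    SwitchingDBM.genL F (SwitchingDBM.normalized A) + R A) ∧
                |SwitchingDBM.unifE R| ≤
                  C * (SwitchingDBM.sparsity N db ^ (-(1 / 2) : ℝ) * (N : ℝ) ^ (1 + ε)) *
                    SwitchingDBM.maxDerivSeminorm db dw r F := by
  -- The power mean inequality needs only r ≥ 1. The three error terms below add up to (1/2 + 5/4 +
  -- 1/2) α₀ = 9α₀/4, rounded up to 3α₀.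
  refine ⟨1, le_rfl, fun γ hγ α₀ hα => ⟨3 * α₀, by positivity, ?_⟩⟩
  intro M N db dw hN hNM hMα hMN hd1 _ r hr F hF
  refine ⟨fun A => SwitchingDBM.genQ (SwitchingDBM.fF db dw F) A -
    SwitchingDBM.genL F (SwitchingDBM.normalized A), fun A => by ring, ?_⟩
  have hM : 0 < M := hN.trans_le hNM
  have hN1 : (1 : ℝ) ≤ N := by exact_mod_cast hN
  have hd1' : (1 : ℝ) ≤ db := (Real.one_le_rpow hN1 hγ.le).trans hd1
  have hd : 0 < db := by exact_mod_cast one_pos.trans_le hd1'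
  have hw : 0 < dw := Nat.pos_of_ne_zero fun h => (Nat.mul_pos hM hd).ne' (by rw [hMN, h, mul_zero])
  have hmain := SwitchingDBM.abs_unifE_genQ_sub_genL_le (db := db) (dw := dw) hF hM hN hd hw
  have hS1 := SwitchingDBM.unifE_supDeriv_le (db := db) (dw := dw) (F := F) (k := 1) (by simp) hr
  have hS2 := SwitchingDBM.unifE_supDeriv_le (db := db) (dw := dw) (F := F) (k := 2) (by simp) hr
  have hS3 := SwitchingDBM.unifE_supDeriv_le (db := db) (dw := dw) (F := F) (k := 3) (by simp) hr
  have hB0 : 0 ≤ SwitchingDBM.maxDerivSeminorm db dw r F :=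
    (div_nonneg (Finset.sum_nonneg fun A _ => SwitchingDBM.supDeriv_nonneg 1 _)
      (Nat.cast_nonneg _)).trans hS1
  have hq1 := SwitchingDBM.inv_sqrt_le_sparsity (db := db) hN hd
  have hq2 := SwitchingDBM.rpow_mul_sq_le_sparsity (db := db) hN hd
  have hqd := SwitchingDBM.rpow_neg_half_sq_mul hd
  set q := (db : ℝ) ^ (-(1 / 2) : ℝ) with hq
  set B := SwitchingDBM.maxDerivSeminorm db dw r F with hB
  set T := SwitchingDBM.sparsity N db ^ (-(1 / 2) : ℝ) * (N : ℝ) with hT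
  have hq0 : 0 < q := by positivity
  have hN0 : (0 : ℝ) < N := by positivity
  have hw1 : (1 : ℝ) ≤ dw := by exact_mod_cast hw
  have hMN' : (M : ℝ) * db = N * dw := by exact_mod_cast hMN
  have hwα : (dw : ℝ) ≤ α₀ * db := by
    have h : (N : ℝ) * dw ≤ N * (α₀ * db) := by
      rw [← hMN', mul_left_comm, ← mul_assoc]
      exact mul_le_mul_of_nonneg_right hMα (by positivity)
    exact le_of_mul_le_mul_left h hN0
  have hT0 : 0 ≤ T := le_trans (by positivity) hq2
  have hqd1 : 1 ≤ q * db := by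
    have h : (1 : ℝ) ^ 2 ≤ (q * db) ^ 2 := by
      calc (1 : ℝ) ^ 2 ≤ db := by simpa using hd1'
        _ = (q * db) ^ 2 := by linear_combination -(db : ℝ) * hqd
    exact (sq_le_sq₀ zero_le_one (by positivity)).1 h
  -- Since q d_b = d_b^{1/2} ≥ 1, the second order errors are dominated by the first order scale q
  -- d_b².
  have hdT : (db : ℝ) ≤ T := by
    refine le_trans ?_ hq2
    calc (db : ℝ) ≤ (q * db) * db := le_mul_of_one_le_left (by positivity) hqd1
      _ = q * db ^ 2 := by ring
  have hc1 : q * db * dw / 2 ≤ α₀ * T / 2 := by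
    have h : q * db * dw ≤ α₀ * T :=
      calc q * db * dw ≤ q * db * (α₀ * db) := mul_le_mul_of_nonneg_left hwα (by positivity)
        _ = α₀ * (q * db ^ 2) := by ring
        _ ≤ α₀ * T := mul_le_mul_of_nonneg_left hq2 (by positivity)
    linarith
  have hwT : (dw : ℝ) ≤ α₀ * T := hwα.trans (mul_le_mul_of_nonneg_left hdT (by positivity))
  have hc2 : 3 * (dw : ℝ) / 4 + 1 / (2 * db) ≤ 5 / 4 * (α₀ * T) := by
    have h : 1 / (2 * (db : ℝ)) ≤ 1 / 2 :=
      one_div_le_one_div_of_le (by norm_num) (by linarith)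
    linarith
  have hc3 : M * q / 2 ≤ α₀ * T / 2 := by
    have h : M * q ≤ α₀ * T :=
      calc M * q ≤ α₀ * N * q := mul_le_mul_of_nonneg_right hMα hq0.le
        _ = α₀ * (q * N) := by ring
        _ ≤ α₀ * T := mul_le_mul_of_nonneg_left
          (mul_le_mul_of_nonneg_right hq1 hN0.le) (by positivity)
    linarith
  have hterm : ∀ {c c' s : ℝ}, 0 ≤ c → c ≤ c' → s ≤ B → c * s ≤ c' * B := fun hc hcc' hs =>
    (mul_le_mul_of_nonneg_left hs hc).trans (mul_le_mul_of_nonneg_right hcc' hB0)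
  -- The estimate holds with N itself; the factor N^ε ≥ 1 enters only here.
  have hNε : (N : ℝ) ≤ (N : ℝ) ^ (1 + ε) := by
    simpa using Real.rpow_le_rpow_of_exponent_le hN1 (by linarith : (1 : ℝ) ≤ 1 + ε)
  have hsp : 0 ≤ SwitchingDBM.sparsity N db ^ (-(1 / 2) : ℝ) := hq0.le.trans hq1
  calc _ ≤ _ := hmain
    _ ≤ α₀ * T / 2 * B + 5 / 4 * (α₀ * T) * B + α₀ * T / 2 * B :=
        add_le_add (add_le_add (hterm (by positivity) hc1 hS1) (hterm (by positivity) hc2 hS2))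
          (hterm (by positivity) hc3 hS3)
    _ ≤ 3 * α₀ * T * B := by
        have h : 0 ≤ α₀ * T * B := by positivity
        linarith
    _ ≤ _ := mul_le_mul_of_nonneg_right (mul_le_mul_of_nonneg_left
        (mul_le_mul_of_nonneg_left hNε hsp) (by positivity)) hB0
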